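/- **Corollary 3.3 ($B_n$-Toda multiple Hamiltonian structure).** Let $n\ge 0$ be an integer (the case $n=0$ is trivial) and $m=2n$. *The $A_m$-Toda brackets.* The $A_m$-Toda phase space $\mathcal T_{m+1}$ is the space $\mathbb R^{2m+1}$ of real tridiagonal matrices of size $m+1$ with diagonal $b_1,\dots,b_{m+1}$, superdiagonal $a_1,\dots,a_m$ and subdiagonal $1,\dots,1$. In the variables $q_1,\dots,q_{m+1},p_1,\dots,p_{m+1}$ with $a_i=e^{q_i-q_{i+1}}$, $b_i=p_i$, let $J_1$ be the canonical Poisson tensor $\{q_i,p_j\}=\delta_{ij}$, and $J_2$ the Poisson tensor with $\{q_i,q_j\}=-1$ for $i<j$, $\{q_i,p_j\}=p_i\delta_{ij}$, $\{p_i,p_{i+1}\}=-e^{q_i-q_{i+1}}$ and $\{p_i,p_j\}=0$ for $|i-j|>1$. For $k\ge 1$ let $\pi_k^A$ be the push-forward to $\mathcal T_{m+1}$, under $(q,p)\mapsto(a,b)$, of $(J_2J_1^{-1})^{k-1}J_1$. Its components are polynomials in $(a,b)$, so $\pi_k^A$ is defined on all of $\mathcal T_{m+1}$; $\pi_1^A$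 is the linear Toda bracket, whose only nonzero brackets of coordinates are, up to skew-symmetry, $\{a_i,b_i\}=a_i$, $\{a_i,b_{i+1}\}=-a_i$, and $\pi_2^A$ is the quadratic one. *The $B_n$-Toda lattice.* Its phase space is the space $\mathbb R^{2n}$ of points $(a_1,\dots,a_n,b_1,\dots,b_n)$, identified with the space of tridiagonal matrices $L$ of size $2n+1$ with diagonal $b_1,\dots,b_n,0,-b_n,\dots,-b_1$, superdiagonal $a_1,\dots,a_n,-a_n,\dots,-a_1$ and subdiagonal $1,\dots,1,-1,\dots,-1$ ($n$ entries of each sign). Put $H_{j}=\frac1{j}\operatorname{tr}L^{j}$, and let $M_+$ be the strictly upper triangular part of a matrix $M$. Let $\phi(a_i,b_i)=(a_{2n+1-i},-b_{2n+2-i})$ on $\mathcal T_{2n+1}$, and let $$\iota(a,b)=(a_1,\dots,a_n,a_n,\dots,a_1;\ b_1,\dots,b_n,0,-b_n,\dots,-b_1),$$ which identifies the $B_n$-Toda phase space with the fixed point set of the involution $\phi$. *Claim.* For every odd $k\ge 1$, $\pi_k^A$ is a Poisson tensor on $\mathcal T_{2n+1}$ and $\phi$ is a Poisson map for it. There is a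 sequence of Poisson tensors $\pi_1,\pi_3,\pi_5,\dots$ on the $B_n$-Toda phase space such that, for every odd $k\ge 1$: 1. $\pi_k$ is induced by $\pi_k^A$ on the fixed point set of $\phi$, that is, $\iota^*\{F,G\}_{\pi_k^A}=\{\iota^*F,\iota^*G\}_{\pi_k}$ for all $\phi$-invariant $F,G\in C^\infty(\mathcal T_{2n+1})$, and $\pi_k$ is the only Poisson tensor with this property; 2. $\pi_{k+2}\,dH_{2l}=\pi_k\,dH_{2l+2}$ for all $l\ge 1$; 3. for all $l\ge 1$, the flow of the Hamiltonian vector field $\pi_k\,dH_{2l}=\{\,\cdot\,,H_{2l}\}_{\pi_k}$ is the $B_n$-Toda flow $\dfrac{dL}{dt}=\big[L,(L^{k+2l-2})_+\big]$. -/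

import Mathlib

open scoped Matrix ContDiff

namespace BnToda

noncomputable section

/-! ## Poisson tensors on a coordinate space `ι → ℝ` -/

/-- The partial derivative `∂f/∂xᵢ` at `x`. -/
def pderiv {ι : Type*} [Fintype ι] [DecidableEq ι] (i : ι) (f : (ι → ℝ) → ℝ) (x : ι → ℝ) : ℝ :=
  fderiv ℝ f x (Pi.single i 1)

/-- A bivector field in coordinates: at the point `x` it is the matrix `{xᵢ, xⱼ}(x)`. -/
abbrev Bivector (ι : Type*) := (ι → ℝ) → Matrix ι ι ℝ

/-- The bracket `{f, g} = ∑ᵢⱼ πᵢⱼ ∂ᵢf ∂ⱼg` of two functions. -/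
def bracket {ι : Type*} [Fintype ι] [DecidableEq ι] (π : Bivector ι) (f g : (ι → ℝ) → ℝ)
    (x : ι → ℝ) : ℝ :=
  ∑ i, ∑ j, π x i j * pderiv i f x * pderiv j g x

/-- The Hamiltonian vector field `π dH = {·, H}`. -/
def hamVec {ι : Type*} [Fintype ι] [DecidableEq ι] (π : Bivector ι) (H : (ι → ℝ) → ℝ)
    (x : ι → ℝ) : ι → ℝ :=
  π x *ᵥ (fun j => pderiv j H x)

/-- A Poisson tensor: a smooth skew-symmetric bivector field with vanishing Schouten bracket
`[π, π]`, that is, whose bracket satisfies the Jacobi identity. -/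
structure IsPoissonTensor {ι : Type*} [Fintype ι] [DecidableEq ι] (π : Bivector ι) : Prop where
  smooth : ∀ i j, ContDiff ℝ ∞ (fun x => π x i j)
  skew : ∀ x i j, π x i j = -π x j i
  jacobi : ∀ x i j k,
    ∑ l, (π x i l * pderiv l (fun y => π y j k) x
        + π x j l * pderiv l (fun y => π y k i) x
        + π x k l * pderiv l (fun y => π y i j) x) = 0

/-- `φ` is a Poisson map of `π` to itself: `{F ∘ φ, G ∘ φ} = {F, G} ∘ φ`. -/
def IsPoissonMap {ι : Type*} [Fintype ι] [DecidableEq ι] (π : Bivector ι)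
    (φ : (ι → ℝ) → (ι → ℝ)) : Prop :=
  ∀ F G : (ι → ℝ) → ℝ, ContDiff ℝ ∞ F → ContDiff ℝ ∞ G →
    ∀ x, bracket π (F ∘ φ) (G ∘ φ) x = bracket π F G (φ x)

/-- `ρ` is induced by `π` on the fixed point set of `φ`, parametrized by `e`:
`e^*{F, G}_π = {e^*F, e^*G}_ρ` for all smooth `φ`-invariant functions `F`, `G`. -/
def IsInducedOnFixedSet {ι κ : Type*} [Fintype ι] [DecidableEq ι] [Fintype κ] [DecidableEq κ]
    (φ : (ι → ℝ) → (ι → ℝ)) (e : (κ → ℝ) → (ι → ℝ)) (π : Bivector ι) (ρ : Bivector κ) : Prop :=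
  ∀ F G : (ι → ℝ) → ℝ, ContDiff ℝ ∞ F → ContDiff ℝ ∞ G → F ∘ φ = F → G ∘ φ = G →
    ∀ y, bracket π F G (e y) = bracket ρ (F ∘ e) (G ∘ e) y

/-! ## The `A_m`-Toda lattice and its hierarchy of brackets

The phase space has the coordinates `a₁, …, a_m` (`Sum.inl`) and `b₁, …, b_{m+1}` (`Sum.inr`). -/

/-- Index set of the coordinates of the `A_m`-Toda phase space. -/
abbrev AIdx (m : ℕ) := Fin m ⊕ Fin (m + 1)

/-- The coordinate `aᵢ`, counted from `0` and extended by zero outside `0 ≤ i < m`. -/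
def aCoord {m : ℕ} (x : AIdx m → ℝ) (i : ℕ) : ℝ :=
  if h : i < m then x (Sum.inl ⟨i, h⟩) else 0

/-- The tridiagonal Lax matrix with diagonal `b`, superdiagonal `a` and subdiagonal `1`. -/
def lax {m : ℕ} (x : AIdx m → ℝ) : Matrix (Fin (m + 1)) (Fin (m + 1)) ℝ :=
  Matrix.of fun i j =>
    if i = j then x (Sum.inr i)
    else if (i : ℕ) + 1 = j then aCoord x i
    else if (j : ℕ) + 1 = i then 1
    else 0

/-- Index set of the canonical coordinates `q₁, …, q_{m+1}` (`Sum.inl`) and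
`p₁, …, p_{m+1}` (`Sum.inr`). -/
abbrev QPIdx (m : ℕ) := Fin (m + 1) ⊕ Fin (m + 1)

/-- The canonical Poisson tensor `{qᵢ, pⱼ} = δᵢⱼ`. -/
def J₁ (m : ℕ) : Matrix (QPIdx m) (QPIdx m) ℝ := Matrix.fromBlocks 0 1 (-1) 0

/-- The inverse of the canonical tensor (see `J₁_mul_J₁inv`). -/
def J₁inv (m : ℕ) : Matrix (QPIdx m) (QPIdx m) ℝ := Matrix.fromBlocks 0 (-1) 1 0

/-- The second Poisson tensor in canonical coordinates,
`{qᵢ, qⱼ} = -1` for `i < j`, `{qᵢ, pⱼ} = pᵢ δᵢⱼ`, `{pᵢ, pᵢ₊₁} = -exp (qᵢ - qᵢ₊₁)`,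
with its entries written through `aᵢ = exp (qᵢ - qᵢ₊₁)`, `bᵢ = pᵢ`. -/
def J₂ {m : ℕ} (x : AIdx m → ℝ) : Matrix (QPIdx m) (QPIdx m) ℝ :=
  Matrix.fromBlocks
    (Matrix.of fun i j => if i < j then -1 else if j < i then 1 else 0)
    (Matrix.diagonal fun i => x (Sum.inr i))
    (-Matrix.diagonal fun i => x (Sum.inr i))
    (Matrix.of fun i j =>
      if (i : ℕ) + 1 = j then -aCoord x i else if (j : ℕ) + 1 = i then aCoord x j else 0)

/-- The recursion operator `J₂ J₁⁻¹`. -/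
def recursionOp {m : ℕ} (x : AIdx m → ℝ) : Matrix (QPIdx m) (QPIdx m) ℝ := J₂ x * J₁inv m

/-- The derivatives `∂aᵢ/∂qⱼ` of `aᵢ = exp (qᵢ - qᵢ₊₁)`. -/
def aJac {m : ℕ} (x : AIdx m → ℝ) : Matrix (Fin m) (Fin (m + 1)) ℝ :=
  Matrix.of fun i j =>
    if j = i.castSucc then x (Sum.inl i) else if j = i.succ then -x (Sum.inl i) else 0

/-- The Jacobian matrix of the Flaschka map `(q, p) ↦ (a, b)`, with
`aᵢ = exp (qᵢ - qᵢ₊₁)` and `bᵢ = pᵢ`, written through `(a, b)`. -/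
def flaschkaJac {m : ℕ} (x : AIdx m → ℝ) : Matrix (AIdx m) (QPIdx m) ℝ :=
  Matrix.fromBlocks (aJac x) 0 0 1

/-- The `k`-th Toda Poisson tensor `π_k`, `k ≥ 1`, on the `A_m`-Toda phase space: the push-forward
along the Flaschka map of `J_k = (J₂ J₁⁻¹)^(k-1) J₁`. Its entries are polynomials in `a`, `b`,
so that it is defined on the whole phase space. (The value at `k = 0` has no meaning.) -/
def todaTensor (m k : ℕ) : Bivector (AIdx m) := fun x =>
  flaschkaJac x * (recursionOp x ^ (k - 1) * J₁ m) * (flaschkaJac x)ᵀ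

/-- The involution `φ(aᵢ, bᵢ) = (a_{m+1-i}, -b_{m+2-i})`. -/
def invol {m : ℕ} (x : AIdx m → ℝ) : AIdx m → ℝ :=
  Sum.elim (fun i => x (Sum.inl i.rev)) (fun i => -x (Sum.inr i.rev))

/-! ## The `B_n`-Toda lattice -/

/-- Index set of the coordinates `a₁, …, a_n` (`Sum.inl`), `b₁, …, b_n` (`Sum.inr`) of the
`B_n`-Toda phase space. -/
abbrev BIdx (n : ℕ) := Fin n ⊕ Fin n

/-- The embedding of the `B_n`-Toda phase space in the `A_{2n}`-Toda phase space,
`(a, b) ↦ (a₁, …, a_n, a_n, …, a₁, b₁, …, b_n, 0, -b_n, …, -b₁)`. -/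
def embed {n : ℕ} (y : BIdx n → ℝ) : AIdx (2 * n) → ℝ :=
  Sum.elim
    (fun i => if h : (i : ℕ) < n then y (Sum.inl ⟨i, h⟩)
      else y (Sum.inl ⟨2 * n - 1 - i, by omega⟩))
    (fun i => if h : (i : ℕ) < n then y (Sum.inr ⟨i, h⟩)
      else if h' : n < (i : ℕ) then -y (Sum.inr ⟨2 * n - i, by omega⟩)
      else 0)

/-- The Lax matrix of the `B_n`-Toda lattice in `so(n, n+1)`: tridiagonal, with
diagonal `b₁, …, b_n, 0, -b_n, …, -b₁`, superdiagonal `a₁, …, a_n, -a_n, …, -a₁` and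
subdiagonal `1, …, 1, -1, …, -1`. -/
def laxB {n : ℕ} (y : BIdx n → ℝ) : Matrix (Fin (2 * n + 1)) (Fin (2 * n + 1)) ℝ :=
  Matrix.of fun i j =>
    if i = j then embed y (Sum.inr i)
    else if (i : ℕ) + 1 = j then
      (if (i : ℕ) < n then aCoord (embed y) i else -aCoord (embed y) i)
    else if (j : ℕ) + 1 = i then (if (j : ℕ) < n then 1 else -1)
    else 0

/-- The functions `H_j = (1/j) tr L^j`, `j ≥ 1`, on the `B_n`-Toda phase space. -/
def hamB {n : ℕ} (j : ℕ) (y : BIdx n → ℝ) : ℝ := (1 / (j : ℝ)) * (laxB y ^ j).trace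

/-- The strictly upper triangular part `M_+` (the component along the positive root vectors). -/
def upperPart {N : ℕ} (M : Matrix (Fin N) (Fin N) ℝ) : Matrix (Fin N) (Fin N) ℝ :=
  Matrix.of fun i j => if i < j then M i j else 0

/-- The right-hand side `[L, (L^r)_+]` of the Lax equation. -/
def laxField {N : ℕ} (r : ℕ) (L : Matrix (Fin N) (Fin N) ℝ) : Matrix (Fin N) (Fin N) ℝ :=
  L * upperPart (L ^ r) - upperPart (L ^ r) * L

/-- The derivative of the `B_n`-Lax matrix along the tangent vector `v` at `y`. -/
def laxBDeriv {n : ℕ} (y v : BIdx n → ℝ) : Matrix (Fin (2 * n + 1)) (Fin (2 * n + 1)) ℝ :=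
  Matrix.of fun i j => fderiv ℝ (fun z : BIdx n → ℝ => laxB z i j) y v

/-! ## Checks on the definitions -/

theorem J₁_mul_J₁inv (m : ℕ) : J₁ m * J₁inv m = 1 := by
  simp [J₁, J₁inv, Matrix.fromBlocks_multiply]

theorem J₁inv_mul_J₁ (m : ℕ) : J₁inv m * J₁ m = 1 := by
  simp [J₁, J₁inv, Matrix.fromBlocks_multiply]

/-- The linear Toda bracket: `{aᵢ, bⱼ} = aᵢ (δᵢⱼ - δᵢ₊₁,ⱼ)`, `{aᵢ, aⱼ} = {bᵢ, bⱼ} = 0`. -/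
theorem todaTensor_one {m : ℕ} (x : AIdx m → ℝ) :
    todaTensor m 1 x = Matrix.fromBlocks 0 (aJac x) (-(aJac x)ᵀ) 0 := by
  simp [todaTensor, flaschkaJac, J₁, Matrix.fromBlocks_multiply, Matrix.fromBlocks_transpose]

theorem todaTensor_two {m : ℕ} (x : AIdx m → ℝ) :
    todaTensor m 2 x = flaschkaJac x * J₂ x * (flaschkaJac x)ᵀ := by
  simp [todaTensor, recursionOp, Matrix.mul_assoc, J₁inv_mul_J₁]

theorem aJac_mul_apply {m : ℕ} {κ : Type*} (x : AIdx m → ℝ) (M : Matrix (Fin (m + 1)) κ ℝ)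
    (i : Fin m) (j : κ) :
    (aJac x * M) i j = x (Sum.inl i) * (M i.castSucc j - M i.succ j) := by
  have h : i.succ ≠ i.castSucc := by simp [Fin.ext_iff]
  have : ∀ l, aJac x i l * M l j = (if l = i.castSucc then x (Sum.inl i) * M l j else 0)
      + (if l = i.succ then -(x (Sum.inl i) * M l j) else 0) := by
    intro l
    by_cases h1 : l = i.castSucc
    · subst h1; simp [aJac, h.symm]
    · by_cases h2 : l = i.succ <;> simp [aJac, h1, h2, h]
  rw [Matrix.mul_apply]
  simp only [this, Finset.sum_add_distrib, Finset.sum_ite_eq', Finset.mem_univ, if_true]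
  ring

/-- The quadratic Toda bracket: `{aᵢ, aᵢ₊₁} = -aᵢ aᵢ₊₁`. -/
theorem todaTensor_two_aa {m : ℕ} (x : AIdx m → ℝ) (i j : Fin m) :
    todaTensor m 2 x (Sum.inl i) (Sum.inl j) = x (Sum.inl i) * x (Sum.inl j) *
      ((if (i : ℕ) = j + 1 then 1 else 0) - (if (i : ℕ) + 1 = j then 1 else 0)) := by
  have key : ∀ (A : Matrix (Fin (m + 1)) (Fin (m + 1)) ℝ),
      (aJac x * A * (aJac x)ᵀ) i j = x (Sum.inl i) * x (Sum.inl j) *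
        ((A i.castSucc j.castSucc - A i.succ j.castSucc)
          - (A i.castSucc j.succ - A i.succ j.succ)) := by
    intro A
    have : (aJac x * A * (aJac x)ᵀ) i j = (aJac x * (aJac x * A)ᵀ) j i := by
      rw [← Matrix.transpose_apply (aJac x * (aJac x * A)ᵀ), Matrix.transpose_mul,
        Matrix.transpose_transpose]
    rw [this, aJac_mul_apply]
    simp only [Matrix.transpose_apply, aJac_mul_apply]
    ring
  rw [todaTensor_two]
  simp only [flaschkaJac, J₂, Matrix.fromBlocks_multiply, Matrix.fromBlocks_transpose]
  simp only [Matrix.fromBlocks_apply₁₁, Matrix.transpose_zero, Matrix.mul_zero, Matrix.zero_mul,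
    add_zero, key]
  congr 1
  simp only [Matrix.of_apply, Fin.lt_def, Fin.val_castSucc, Fin.val_succ]
  split_ifs <;> first | omega | norm_num

/-- The quadratic Toda bracket: `{aᵢ, bⱼ} = aᵢ bⱼ (δᵢⱼ - δᵢ₊₁,ⱼ)`. -/
theorem todaTensor_two_ab {m : ℕ} (x : AIdx m → ℝ) (i : Fin m) (j : Fin (m + 1)) :
    todaTensor m 2 x (Sum.inl i) (Sum.inr j) = x (Sum.inl i) * x (Sum.inr j) *
      ((if (i : ℕ) = j then 1 else 0) - (if (i : ℕ) + 1 = j then 1 else 0)) := by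
  rw [todaTensor_two]
  simp only [flaschkaJac, J₂, Matrix.fromBlocks_multiply, Matrix.fromBlocks_transpose]
  simp only [Matrix.fromBlocks_apply₁₂, Matrix.transpose_zero, Matrix.mul_zero, Matrix.zero_mul,
    add_zero, zero_add, Matrix.transpose_one, Matrix.mul_one, aJac_mul_apply]
  simp only [Matrix.diagonal_apply, Fin.ext_iff, Fin.val_castSucc, Fin.val_succ, mul_assoc]
  congr 1
  split_ifs <;> first | omega | simp_all
  · rename_i h; congr 2; exact Fin.ext h
  · rename_i h; congr 2; exact Fin.ext h

/-- The quadratic Toda bracket: `{bᵢ, bᵢ₊₁} = -aᵢ`. -/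
theorem todaTensor_two_bb {m : ℕ} (x : AIdx m → ℝ) (i j : Fin (m + 1)) :
    todaTensor m 2 x (Sum.inr i) (Sum.inr j) =
      if (i : ℕ) + 1 = j then -aCoord x i else if (j : ℕ) + 1 = i then aCoord x j else 0 := by
  rw [todaTensor_two]
  simp [flaschkaJac, J₂, Matrix.fromBlocks_multiply, Matrix.fromBlocks_transpose]

theorem invol_invol {m : ℕ} (x : AIdx m → ℝ) : invol (invol x) = x := by
  funext i
  rcases i with i | i <;> simp [invol]

theorem embed_injective (n : ℕ) : Function.Injective (embed (n := n)) := by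
  intro y z h
  funext i
  rcases i with i | i
  · have := congrFun h (Sum.inl ⟨i, by omega⟩)
    simpa [embed] using this
  · have := congrFun h (Sum.inr ⟨i, by omega⟩)
    simpa [embed] using this

/-- The embedded `B_n`-Toda phase space is the fixed point set of the involution. -/
theorem range_embed (n : ℕ) :
    Set.range (embed (n := n)) = {x : AIdx (2 * n) → ℝ | invol x = x} := by
  ext x
  constructor
  · rintro ⟨y, rfl⟩
    funext i
    rcases i with i | i
    · have := i.isLt
      simp only [invol, embed, Sum.elim_inl, Fin.val_rev]
      split_ifs <;> first | omega | (congr 3; omega)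
    · have := i.isLt
      simp only [invol, embed, Sum.elim_inr, Fin.val_rev]
      split_ifs <;> first
        | omega
        | (simp only [neg_neg, neg_inj, neg_zero]; done)
        | (simp only [neg_neg, neg_inj]; congr 3; omega)
  · intro hx
    have hx : invol x = x := hx
    have ha : ∀ i : Fin (2 * n), x (Sum.inl i.rev) = x (Sum.inl i) := fun i => by
      simpa [invol] using congrFun hx (Sum.inl i)
    have hb : ∀ i : Fin (2 * n + 1), -x (Sum.inr i.rev) = x (Sum.inr i) := fun i => by
      simpa [invol] using congrFun hx (Sum.inr i)
    refine ⟨Sum.elim (fun i => x (Sum.inl ⟨i, by omega⟩)) (fun i => x (Sum.inr ⟨i, by omega⟩)), ?_⟩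
    funext i
    rcases i with i | i
    · simp only [embed, Sum.elim_inl]
      split_ifs
      · rfl
      · rw [← ha i]; congr 2; ext; simp [Fin.val_rev]; omega
    · simp only [embed, Sum.elim_inr]
      split_ifs
      · rfl
      · rw [← hb i]; congr 3; ext; simp [Fin.val_rev]
      · have h := hb i
        have : i.rev = i := by ext; simp only [Fin.val_rev]; omega
        rw [this] at h
        linarith

/-- The `B_n`-Lax matrix is conjugate, by a diagonal matrix of signs, to the `A_{2n}`-Lax matrix
of the embedded point. -/
theorem laxB_eq_conj {n : ℕ} (y : BIdx n → ℝ) :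
    laxB y = Matrix.diagonal (fun i : Fin (2 * n + 1) => (-1 : ℝ) ^ ((i : ℕ) - n)) * lax (embed y) *
      Matrix.diagonal (fun i : Fin (2 * n + 1) => (-1 : ℝ) ^ ((i : ℕ) - n)) := by
  ext i j
  rw [Matrix.mul_diagonal, Matrix.diagonal_mul]
  have hsq : ∀ k : ℕ, (-1 : ℝ) ^ k * (-1) ^ k = 1 := fun k => by rw [← mul_pow]; simp
  simp only [laxB, lax, Matrix.of_apply]
  by_cases h1 : i = j
  · subst h1
    simp only [if_true]
    linear_combination (-embed y (Sum.inr i)) * hsq ((i : ℕ) - n)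
  by_cases h2 : (i : ℕ) + 1 = j
  · simp only [h1, h2, if_true, if_false]
    rw [← h2]
    by_cases h : (i : ℕ) < n
    · rw [if_pos h, Nat.sub_eq_zero_of_le h.le, Nat.sub_eq_zero_of_le h]; simp
    · rw [if_neg h, show (i : ℕ) + 1 - n = (i : ℕ) - n + 1 by omega, pow_succ]
      linear_combination (aCoord (embed y) i) * hsq ((i : ℕ) - n)
  by_cases h3 : (j : ℕ) + 1 = i
  · simp only [h1, h2, h3, if_true, if_false]
    rw [← h3]
    by_cases h : (j : ℕ) < n
    · rw [if_pos h, Nat.sub_eq_zero_of_le h.le, Nat.sub_eq_zero_of_le h]; simp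
    · rw [if_neg h, show (j : ℕ) + 1 - n = (j : ℕ) - n + 1 by omega, pow_succ]
      linear_combination hsq ((j : ℕ) - n)
  · simp [h1, h2, h3]

end

end BnToda

namespace BnToda

/-! ### Nijenhuis torsion, closed 2-forms and Jacobi identities over a ring with derivations -/

section Nijenhuis

variable {𝕜 R κ : Type*} [CommRing 𝕜] [CommRing R] [Algebra 𝕜 R] [Fintype κ]
  (D : κ → Derivation 𝕜 R R)

/-! The brackets come from a Poisson–Nijenhuis structure. The operator N = J₂ J₁⁻¹ has zero
Nijenhuis torsion (`torsion_recMat`), and the 2-forms J₁⁻¹ and J₁⁻¹ N are closed. Hence every power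
of N is torsion-free (`torsion_pow`) and every J₁⁻¹ N^a is closed (`closed_mul_pow`); together these
give the Jacobi identity for N^a J₁, with no invertibility of N (`jacobiator_of_closed`), and
`jacobiator_pushforward` carries it to the variables (a, b). The computation uses derivations of the
polynomial ring in a, b that mimic ∂/∂q and ∂/∂p, so the result holds on the whole phase space and
not only where all aᵢ are positive.

The hierarchy rests on the Lenard relation N J₁ dH_l = J₁ dH_{l+1}
(`recMat_mulVec_symp_mulVec_grad`). By it π_k dH_j depends only on k + j, and it is the Lax field of
exponent k + j - 2 (`laxField_lax`).

The involution φ lifts to the symplectic map (q, p) ↦ (-rev q, -rev p), which turns N into -N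
(`canonInvol_mul_recMat`). So even powers of N, that is odd k, give φ-invariant tensors. If E is the
matrix of ι, then EᵀE = 2 and EEᵀ = 1 + φ; thus ½Eᵀ is a left inverse of E, ½EEᵀ projects onto the
fixed set, and the induced tensor is ¼EᵀπE (`bTensor`). For even j the function H_j is φ-invariant
(`hamA_invol`), so for odd k its Hamiltonian field is tangent to the fixed set and restricts to the
B-field. There the two Lax matrices are conjugate by a diagonal matrix of signs, and such a
conjugation commutes with taking the upper triangular part. -/

theorem map_derivation_mul {l m n : Type*} [Fintype m] (d : Derivation 𝕜 R R)
    (A : Matrix l m R) (B : Matrix m n R) :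
    (A * B).map d = A.map d * B + A * B.map d := by
  ext i j
  simp only [Matrix.map_apply, Matrix.mul_apply, Matrix.add_apply, map_sum, Derivation.leibniz,
    smul_eq_mul, Finset.sum_add_distrib]
  rw [add_comm]
  congr 1
  exact Finset.sum_congr rfl fun _ _ => mul_comm _ _

theorem map_derivation_transpose {m n : Type*} (d : Derivation 𝕜 R R) (A : Matrix m n R) :
    Aᵀ.map d = (A.map d)ᵀ := rfl

theorem derivation_trace_pow {n : Type*} [Fintype n] [DecidableEq n]
    (d : Derivation 𝕜 R R) (A : Matrix n n R) (j : ℕ) :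
    d (A ^ (j + 1)).trace = (j + 1) * (A ^ j * A.map d).trace := by
  have htr : ∀ B : Matrix n n R, d B.trace = (B.map d).trace := fun B => by
    simp [Matrix.trace, map_sum]
  -- The extra factor B commuting with A absorbs the powers of A that cyclicity of the trace moves
  -- to the left; it makes the induction close.
  have key : ∀ (j : ℕ) (B : Matrix n n R), Commute B A →
      (B * (A ^ (j + 1)).map d).trace = (j + 1) * (B * A ^ j * A.map d).trace := by
    intro j
    induction j with
    | zero => intro B _; simp
    | succ j ih =>
      intro B hB
      rw [pow_succ _ (j + 1), map_derivation_mul, mul_add, Matrix.trace_add, ← mul_assoc, ← mul_assoc,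
        Matrix.trace_mul_comm (B * _) A, ← mul_assoc, ← hB.eq,
        ih (B * A) (hB.mul_left (Commute.refl A)), mul_assoc B A, ← pow_succ']
      push_cast
      ring
  have := key j 1 (Commute.one_left A)
  rw [htr]
  simpa using this

/-- The derivation along a vector field `u`. -/
noncomputable def dirDeriv (u : κ → R) : Derivation 𝕜 R R := ∑ i, u i • D i

theorem dirDeriv_apply (u : κ → R) (f : R) : dirDeriv D u f = ∑ i, u i * D i f := by
  simp only [dirDeriv, ← Derivation.coeFnAddMonoidHom_apply, map_sum, Finset.sum_apply]
  rfl

/-- The Jacobian matrix of a vector field. -/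
def jacobian (u : κ → R) : Matrix κ κ R := Matrix.of fun i j => D j (u i)

/-- The Lie derivative of a `(1,1)`-tensor along a vector field. -/
noncomputable def lieDeriv (u : κ → R) (A : Matrix κ κ R) : Matrix κ κ R :=
  A.map (dirDeriv D u) - jacobian D u * A + A * jacobian D u

theorem lieDeriv_mul (u : κ → R) (A B : Matrix κ κ R) :
    lieDeriv D u (A * B) = lieDeriv D u A * B + A * lieDeriv D u B := by
  simp only [lieDeriv, map_derivation_mul]
  noncomm_ring

variable [DecidableEq κ]

theorem lieDeriv_one (u : κ → R) : lieDeriv D u 1 = 0 := by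
  have : (1 : Matrix κ κ R).map (dirDeriv D u) = 0 := by
    ext i j
    by_cases h : i = j <;> simp [h]
  simp [lieDeriv, this]

/-- The Nijenhuis torsion `T(eᵢ, eⱼ)ₖ` of a `(1,1)`-tensor. -/
def torsion (N : Matrix κ κ R) (i j k : κ) : R :=
  ∑ l, (N l i * D l (N k j) - N l j * D l (N k i) - N k l * (D i (N l j) - D j (N l i)))

/-- The derivatives of u cancel, so the difference is tensorial in u and the torsion is its
coefficient. The derivations need not commute. -/
theorem lieDeriv_mulVec_sub_apply (N : Matrix κ κ R) (u : κ → R) (k j : κ) :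
    (lieDeriv D (N *ᵥ u) N - N * lieDeriv D u N) k j = ∑ i, u i * torsion D N i j k := by
  have hJ : jacobian D (N *ᵥ u) =
      (Matrix.of fun k l => ∑ i, u i * D l (N k i)) + N * jacobian D u := by
    ext k l
    simp [jacobian, Matrix.mulVec, dotProduct, Matrix.mul_apply, Finset.sum_add_distrib, add_comm]
  have : lieDeriv D (N *ᵥ u) N - N * lieDeriv D u N = N.map (dirDeriv D (N *ᵥ u))
      - (Matrix.of fun k l => ∑ i, u i * D l (N k i)) * N
      + N * (Matrix.of fun k l => ∑ i, u i * D l (N k i)) - N * N.map (dirDeriv D u) := by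
    simp only [lieDeriv, hJ]
    noncomm_ring
  rw [this]
  simp only [Matrix.sub_apply, Matrix.add_apply, Matrix.mul_apply, Matrix.map_apply, Matrix.of_apply,
    dirDeriv_apply, Matrix.mulVec, dotProduct, torsion, Finset.mul_sum, Finset.sum_mul]
  rw [Finset.sum_comm (f := fun i l => u i * _)]
  simp only [← Finset.sum_sub_distrib, ← Finset.sum_add_distrib]
  exact Finset.sum_congr rfl fun _ _ => Finset.sum_congr rfl fun _ _ => by ring

theorem torsion_eq_zero_iff (N : Matrix κ κ R) :
    (∀ i j k, torsion D N i j k = 0) ↔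
      ∀ u, lieDeriv D (N *ᵥ u) N = N * lieDeriv D u N := by
  constructor
  · intro h u
    rw [← sub_eq_zero]
    ext k j
    rw [lieDeriv_mulVec_sub_apply]
    simp [h]
  · intro h i j k
    have := lieDeriv_mulVec_sub_apply D N (Pi.single i 1) k j
    rw [h, sub_self] at this
    simpa [Pi.single_apply] using this.symm

/-- Because `lieDeriv` obeys the Leibniz rule, L_{Nu} N = N L_u N extends to L_{Nu} N^a = N L_u N^a
by induction on a; iterating in u gives a factor N^b, and b = a is the claim. -/
theorem torsion_pow (N : Matrix κ κ R) (h : ∀ i j k, torsion D N i j k = 0) (a : ℕ) (i j k : κ) :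
    torsion D (N ^ a) i j k = 0 := by
  rw [torsion_eq_zero_iff] at h
  have h1 : ∀ (a : ℕ) u, lieDeriv D (N *ᵥ u) (N ^ a) = N * lieDeriv D u (N ^ a) := by
    intro a u
    induction a with
    | zero => simp [lieDeriv_one]
    | succ a ih =>
      rw [pow_succ, lieDeriv_mul, lieDeriv_mul, ih, h, mul_add, mul_assoc, ← mul_assoc (N ^ a) N,
        ← pow_succ, pow_succ', mul_assoc N (N ^ a)]
  have h2 : ∀ (b : ℕ) u, lieDeriv D (N ^ b *ᵥ u) (N ^ a) = N ^ b * lieDeriv D u (N ^ a) := by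
    intro b u
    induction b with
    | zero => simp
    | succ b ih => rw [pow_succ', ← Matrix.mulVec_mulVec, h1, ih, mul_assoc]
  exact (torsion_eq_zero_iff D _).2 (h2 a) i j k

/-- The exterior derivative of the 2-form with matrix `W`. -/
def extDeriv₂ (W : Matrix κ κ R) (i j k : κ) : R := D i (W j k) + D j (W k i) + D k (W i j)

/-- With x, y, z the basis fields i, j, k, this is dW(Nx, Ny, z) - d(WN)(Nx, y, z) - d(WN)(x, Ny, z)
+ d(WN²)(x, y, z) = -W(T(x, y), z). It determines d(WN²) from dW, d(WN) and the torsion. -/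
theorem extDeriv₂_torsion (N W : Matrix κ κ R) (hW : Wᵀ = -W) (hN : Nᵀ * W = W * N) (i j k : κ) :
    (∑ p, ∑ q, N p i * N q j * extDeriv₂ D W p q k)
      - (∑ p, N p i * extDeriv₂ D (W * N) p j k) - (∑ q, N q j * extDeriv₂ D (W * N) i q k)
      + extDeriv₂ D (W * N * N) i j k = -∑ l, torsion D N i j l * W l k := by
  set di := dirDeriv D (fun p => N p i) with hdi
  set dj := dirDeriv D (fun p => N p j) with hdj
  have hW' : ∀ a b, W a b = -W b a := fun a b => by
    rw [← Matrix.transpose_apply W a b, hW, Matrix.neg_apply, neg_neg]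
  have e1 : (∑ p, ∑ q, N p i * N q j * extDeriv₂ D W p q k) =
      (Nᵀ * W.map di) j k + (W.map dj * N) k i + (Nᵀ * W.map (D k) * N) i j := by
    simp only [extDeriv₂, hdi, hdj, Matrix.mul_apply, Matrix.map_apply, dirDeriv_apply,
      Matrix.transpose_apply, Finset.mul_sum, Finset.sum_mul, mul_add, Finset.sum_add_distrib]
    congr 1
    · congr 1
      · rw [Finset.sum_comm]
        exact Finset.sum_congr rfl fun _ _ => Finset.sum_congr rfl fun _ _ => by ring
      · exact Finset.sum_congr rfl fun _ _ => Finset.sum_congr rfl fun _ _ => by ring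
    · rw [Finset.sum_comm]
      exact Finset.sum_congr rfl fun _ _ => Finset.sum_congr rfl fun _ _ => by ring
  have e2 : (∑ p, N p i * extDeriv₂ D (W * N) p j k) =
      ((N.map di)ᵀ * W + Nᵀ * W.map di) j k + ((W * N).map (D j) * N) k i + (Nᵀ * (W * N).map (D k)) i j := by
    rw [← map_derivation_transpose, ← map_derivation_mul, hN]
    simp only [extDeriv₂, hdi, Matrix.mul_apply, Matrix.map_apply, dirDeriv_apply,
      Matrix.transpose_apply, mul_add, Finset.sum_add_distrib]
    congr 2
    exact Finset.sum_congr rfl fun _ _ => mul_comm _ _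
  have e3 : (∑ q, N q j * extDeriv₂ D (W * N) i q k) =
      (Nᵀ * (W * N).map (D i)) j k + ((W * N).map dj) k i + ((W * N).map (D k) * N) i j := by
    simp only [extDeriv₂, hdj, Matrix.mul_apply, Matrix.map_apply, dirDeriv_apply,
      Matrix.transpose_apply, mul_add, Finset.sum_add_distrib]
    congr 1
    exact Finset.sum_congr rfl fun _ _ => mul_comm _ _
  have e4 : extDeriv₂ D (W * N * N) i j k = ((N.map (D i))ᵀ * (W * N) + Nᵀ * (W * N).map (D i)) j k
      + ((W * N * N).map (D j)) k i + ((W * N * N).map (D k)) i j := by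
    rw [← map_derivation_transpose, ← map_derivation_mul, ← mul_assoc Nᵀ, hN]; rfl
  have e5 : ∑ l, torsion D N i j l * W l k = ((N.map di)ᵀ * W) j k + (W * N.map dj) k i
      - ((N.map (D i))ᵀ * (Nᵀ * W)) j k - (W * (N * N.map (D j))) k i := by
    simp only [torsion, hdi, hdj, Matrix.mul_apply, Matrix.map_apply, dirDeriv_apply,
      Matrix.transpose_apply, hW' k, Finset.mul_sum, Finset.sum_mul]
    rw [Finset.sum_comm (f := fun x i_1 => D i (N x j) * _)]
    simp only [← Finset.sum_sub_distrib, ← Finset.sum_add_distrib]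
    exact Finset.sum_congr rfl fun _ _ => Finset.sum_congr rfl fun _ _ => by ring
  rw [e1, e2, e3, e4, e5]
  -- The terms differentiated along k carry no torsion; they cancel among themselves by the Leibniz
  -- rule and NᵀW = WN.
  have hk : (Nᵀ * W.map (D k) * N) - Nᵀ * (W * N).map (D k) - (W * N).map (D k) * N
      + (W * N * N).map (D k) = 0 := by
    rw [map_derivation_mul _ (W * N), ← hN, hN, map_derivation_mul _ W, mul_add, ← mul_assoc Nᵀ W, hN]
    noncomm_ring
  have hk' := congrFun₂ hk i j
  simp only [map_derivation_mul, mul_add, add_mul, hN, Matrix.add_apply,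
    Matrix.sub_apply, Matrix.zero_apply, mul_assoc] at hk' ⊢
  linear_combination hk'

/-- `extDeriv₂_torsion` for the form W N^a passes closedness from the exponents a and a + 1 to a +
2. -/
theorem closed_mul_pow (N W : Matrix κ κ R) (hW : Wᵀ = -W) (hN : Nᵀ * W = W * N)
    (hT : ∀ i j k, torsion D N i j k = 0) (h0 : ∀ i j k, extDeriv₂ D W i j k = 0)
    (h1 : ∀ i j k, extDeriv₂ D (W * N) i j k = 0) (a : ℕ) (i j k : κ) :
    extDeriv₂ D (W * N ^ a) i j k = 0 := by
  induction a using Nat.twoStepInduction generalizing i j k with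
  | zero => simpa using h0 i j k
  | one => simpa using h1 i j k
  | more a ih0 ih1 =>
    have hNa : Nᵀ * (W * N ^ a) = W * N ^ a * N := by
      rw [← mul_assoc, hN, mul_assoc, mul_assoc, ← pow_succ, ← pow_succ']
    have hWa : ∀ a : ℕ, (W * N ^ a)ᵀ = -(W * N ^ a) := by
      intro a
      induction a with
      | zero => simpa using hW
      | succ a ih =>
        rw [pow_succ, ← mul_assoc, Matrix.transpose_mul, ih, mul_neg, ← mul_assoc, hN, mul_assoc W N,
          ← pow_succ', pow_succ, mul_assoc]
    have := extDeriv₂_torsion D N (W * N ^ a) (hWa a) hNa i j k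
    rw [mul_assoc W, ← pow_succ, mul_assoc W, ← pow_succ] at this
    simpa [ih0, ih1, hT] using this

/-- The left-hand side of the Jacobi identity of a bivector. -/
def jacobiator (P : Matrix κ κ R) (i j k : κ) : R :=
  ∑ l, (P i l * D l (P j k) + P j l * D l (P k i) + P k l * D l (P i j))

/-- Closedness of W replaces D_a W_bs - D_b W_as by a derivative of W_ab, so the vanishing torsion
of A = JW says that an antisymmetrized derivative of A equals the derivative of W along a row of P =
AJ. Conjugating by the constant J, with J W Jᵀ = -P, turns this into the Jacobi identity of P.
Neither A nor P has to be invertible. -/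
theorem jacobiator_of_closed (A J W : Matrix κ κ R) (hJc : ∀ i j l, D l (J i j) = 0)
    (hJ : Jᵀ = -J) (hJW : J * W = A) (hWt : Wᵀ = -W) (hAJ : A * J = J * Aᵀ)
    (hT : ∀ i j k, torsion D A i j k = 0) (hW : ∀ i j k, extDeriv₂ D W i j k = 0) (i j k : κ) :
    jacobiator D (A * J) i j k = 0 := by
  set P := A * J with hP
  have hPt : Pᵀ = -P := by rw [hP, Matrix.transpose_mul, hJ, neg_mul, ← hAJ]
  have hPs : ∀ a b, P a b = -P b a := fun a b => by
    rw [← Matrix.transpose_apply P a b, hPt, Matrix.neg_apply, neg_neg]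
  have hWs : ∀ a b, W a b = -W b a := fun a b => by
    rw [← Matrix.transpose_apply W a b, hWt, Matrix.neg_apply, neg_neg]
  have hJd : ∀ d : κ → R, J.map (dirDeriv D d) = 0 := fun d => by
    ext a b; simp [dirDeriv_apply, hJc]
  set G : Matrix κ κ R := Matrix.of fun l j => D l (A k j) with hG
  have hDA : ∀ a b l, D a (A l b) = ∑ s, J l s * D a (W s b) := fun a b l => by
    rw [← hJW, Matrix.mul_apply, map_sum]
    simp [hJc]
  have h1 : Aᵀ * G - (Aᵀ * G)ᵀ = W.map (dirDeriv D (P k)) := by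
    ext a b
    have h := hT a b k
    have h2 : ∑ l, A k l * (D a (A l b) - D b (A l a)) = dirDeriv D (P k) (W a b) := by
      simp only [hDA, dirDeriv_apply, hP, Matrix.mul_apply, ← Finset.sum_sub_distrib,
        Finset.mul_sum, Finset.sum_mul]
      rw [Finset.sum_comm]
      refine Finset.sum_congr rfl fun s _ => Finset.sum_congr rfl fun l _ => ?_
      have h3 := hW a b s
      rw [extDeriv₂, hWs b s, map_neg] at h3
      linear_combination (-A k l * J l s) * h3
    rw [Matrix.map_apply, ← h2, ← sub_eq_zero]
    simp only [Matrix.sub_apply, Matrix.transpose_apply, Matrix.mul_apply, hG, Matrix.of_apply,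
      ← Finset.sum_sub_distrib]
    exact h
  have h2 : J * (Aᵀ * G - (Aᵀ * G)ᵀ) * Jᵀ = -P.map (dirDeriv D (P k)) := by
    have hn : ∀ d : Derivation 𝕜 R R, P.map d = -((J * W * Jᵀ).map d) := fun d => by
      have : P = -(J * W * Jᵀ) := by rw [hJW, hJ, mul_neg, neg_neg]
      rw [this]
      ext a b
      simp
    rw [h1, hn, neg_neg, map_derivation_mul, map_derivation_mul, map_derivation_transpose, hJd]
    simp
  have h3 : ∀ a b, (J * (Aᵀ * G) * Jᵀ) a b = ∑ l, P a l * D l (P b k) := by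
    intro a b
    have : G * Jᵀ = Matrix.of fun l b => D l (P b k) := by
      ext l b
      rw [Matrix.of_apply, hPs, hP, Matrix.mul_apply, Matrix.mul_apply, map_neg, map_sum,
        ← Finset.sum_neg_distrib]
      refine Finset.sum_congr rfl fun s _ => ?_
      rw [hJ]
      simp [hG, hJc, mul_comm]
    rw [← mul_assoc, ← hAJ, mul_assoc, this, Matrix.mul_apply]
    rfl
  have h4 : (J * (Aᵀ * G)ᵀ * Jᵀ) i j = (J * (Aᵀ * G) * Jᵀ) j i := by
    have : J * (Aᵀ * G)ᵀ * Jᵀ = (J * (Aᵀ * G) * Jᵀ)ᵀ := by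
      simp [Matrix.transpose_mul, mul_assoc]
    rw [this, Matrix.transpose_apply]
  have h5 := congrFun₂ h2 i j
  rw [mul_sub, sub_mul, Matrix.sub_apply, h4, h3, h3, Matrix.neg_apply, Matrix.map_apply,
    dirDeriv_apply] at h5
  have h6 : ∑ l, P j l * D l (P k i) = - ∑ l, P j l * D l (P i k) := by
    simp only [hPs k i, map_neg, mul_neg, Finset.sum_neg_distrib]
  rw [jacobiator, Finset.sum_add_distrib, Finset.sum_add_distrib, h6]
  linear_combination h5

/-- F plays the Jacobian of a map, and `hF` is the symmetry of its second derivatives. In the cyclic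
sum the second derivatives cancel, which leaves the Jacobiator of P contracted with three copies of
F. It serves both for the Flaschka map and for the constant matrix Eᵀ. -/
theorem jacobiator_pushforward {ι : Type*} (P : Matrix κ κ R) (F : Matrix ι κ R) (hP : Pᵀ = -P)
    (hF : ∀ j β γ, D β (F j γ) = D γ (F j β)) (hJ : ∀ i j k, jacobiator D P i j k = 0) (i j k : ι) :
    dirDeriv D ((F * P) i) ((F * P * Fᵀ) j k) + dirDeriv D ((F * P) j) ((F * P * Fᵀ) k i)
      + dirDeriv D ((F * P) k) ((F * P * Fᵀ) i j) = 0 := by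
  have hPF : P * Fᵀ = -(F * P)ᵀ := by rw [Matrix.transpose_mul, hP, Matrix.neg_mul, neg_neg]
  set Y := F * P with hY
  -- The Hessian of the component j, evaluated on the fields Y i and Y i'.
  let H : ι → ι → ι → R := fun j i i' => ∑ β, ∑ γ, Y i β * D β (F j γ) * Y i' γ
  have hH : ∀ j i i', H j i i' = H j i' i := fun j i i' => by
    simp only [H]
    rw [Finset.sum_comm]
    exact Finset.sum_congr rfl fun _ _ => Finset.sum_congr rfl fun _ _ => by rw [hF]; ring
  have hHm : ∀ i j k, (F.map (dirDeriv D (Y i)) * Yᵀ) j k = H j i k := fun i j k => by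
    simp only [Matrix.mul_apply, Matrix.map_apply, dirDeriv_apply, Matrix.transpose_apply, H,
      Finset.sum_mul]
    rw [Finset.sum_comm]
  let c : κ → κ → κ → R := fun α γ δ => ∑ β, P α β * D β (P γ δ)
  have rot : ∀ g : κ → κ → κ → R, ∑ α, ∑ γ, ∑ δ, g α γ δ = ∑ α, ∑ γ, ∑ δ, g δ α γ := fun g => by
    calc _ = ∑ α, ∑ δ, ∑ γ, g δ α γ := Finset.sum_comm
      _ = _ := Finset.sum_congr rfl fun _ _ => Finset.sum_comm
  have hc : ∀ i γ δ, dirDeriv D (Y i) (P γ δ) = ∑ α, F i α * c α γ δ := fun i γ δ => by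
    simp only [dirDeriv_apply, hY, Matrix.mul_apply, c, Finset.mul_sum, Finset.sum_mul]
    rw [Finset.sum_comm]
    simp only [mul_assoc]
  have key : ∀ i j k, dirDeriv D (Y i) ((Y * Fᵀ) j k) = H k i j - H j i k
      + ∑ α, ∑ γ, ∑ δ, F i α * F j γ * F k δ * c α γ δ := by
    intro i j k
    have hd : ∀ d : Derivation 𝕜 R R, (Y * Fᵀ).map d =
        -(F.map d * Yᵀ) + F * P.map d * Fᵀ + (F.map d * Yᵀ)ᵀ := fun d => by
      rw [map_derivation_mul, hY, map_derivation_mul, Matrix.add_mul, Matrix.mul_assoc _ P, hPF,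
        map_derivation_transpose, Matrix.mul_neg, ← hY, Matrix.transpose_mul _ Yᵀ,
        Matrix.transpose_transpose]
    rw [← Matrix.map_apply (f := dirDeriv D (Y i)), hd, Matrix.add_apply, Matrix.add_apply,
      Matrix.neg_apply, Matrix.transpose_apply, hHm, hHm]
    have : (F * P.map (dirDeriv D (Y i)) * Fᵀ) j k =
        ∑ α, ∑ γ, ∑ δ, F i α * F j γ * F k δ * c α γ δ := by
      simp only [Matrix.mul_apply, Matrix.map_apply, hc, Matrix.transpose_apply, Finset.mul_sum,
        Finset.sum_mul]
      rw [Finset.sum_comm, rot, rot]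
      exact Finset.sum_congr rfl fun _ _ => Finset.sum_congr rfl fun _ _ =>
        Finset.sum_congr rfl fun _ _ => by ring
    rw [this]
    ring
  rw [key, key, key]
  have r1 : ∑ α, ∑ γ, ∑ δ, F j α * F k γ * F i δ * c α γ δ =
      ∑ α, ∑ γ, ∑ δ, F i α * F j γ * F k δ * c γ δ α := by
    rw [rot, rot]
    simp only [mul_comm, mul_left_comm]
  have r2 : ∑ α, ∑ γ, ∑ δ, F k α * F i γ * F j δ * c α γ δ =
      ∑ α, ∑ γ, ∑ δ, F i α * F j γ * F k δ * c δ α γ := by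
    rw [rot]
    simp only [mul_comm, mul_left_comm]
  have r3 : ∑ α, ∑ γ, ∑ δ, F i α * F j γ * F k δ * c α γ δ
      + ∑ α, ∑ γ, ∑ δ, F i α * F j γ * F k δ * c γ δ α
      + ∑ α, ∑ γ, ∑ δ, F i α * F j γ * F k δ * c δ α γ = 0 := by
    simp only [← Finset.sum_add_distrib]
    refine Finset.sum_eq_zero fun α _ => Finset.sum_eq_zero fun γ _ => Finset.sum_eq_zero fun δ _ => ?_
    have := hJ α γ δ
    simp only [jacobiator, Finset.sum_add_distrib] at this
    simp only [c]
    linear_combination (F i α * F j γ * F k δ) * this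
  rw [r1, r2]
  linear_combination r3 + hH j k i + hH k i j + hH i j k

end Nijenhuis

/-! ### Lax matrix, recursion operator and Flaschka Jacobian over any commutative ring -/

section Generic

variable {R : Type*} [CommRing R] {m : ℕ}

/-- The superdiagonal part of the Lax matrix. -/
def supDiag (x : AIdx m → R) : Matrix (Fin (m + 1)) (Fin (m + 1)) R :=
  Matrix.of fun i j => if h : (i : ℕ) + 1 = j then x (Sum.inl ⟨i, by omega⟩) else 0

/-- The matrix with ones on the subdiagonal. -/
def subDiag (R : Type*) [CommRing R] (m : ℕ) : Matrix (Fin (m + 1)) (Fin (m + 1)) R :=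
  Matrix.of fun i j => if (j : ℕ) + 1 = i then 1 else 0

/-- The diagonal part of the Lax matrix. -/
def diagPart (x : AIdx m → R) : Matrix (Fin (m + 1)) (Fin (m + 1)) R :=
  Matrix.diagonal fun i => x (Sum.inr i)

/-- The matrix of signs of `i - j`. -/
def signMat (R : Type*) [CommRing R] (m : ℕ) : Matrix (Fin (m + 1)) (Fin (m + 1)) R :=
  Matrix.of fun i j => if i < j then -1 else if j < i then 1 else 0

/-- The Lax matrix over a commutative ring. -/
def laxMat (x : AIdx m → R) : Matrix (Fin (m + 1)) (Fin (m + 1)) R :=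
  supDiag x + diagPart x + subDiag R m

/-- The matrix of the brackets `{pᵢ, pⱼ}`. -/
def skewPart (x : AIdx m → R) : Matrix (Fin (m + 1)) (Fin (m + 1)) R := (supDiag x)ᵀ - supDiag x

/-- The recursion operator over a commutative ring. -/
def recMat (x : AIdx m → R) : Matrix (QPIdx m) (QPIdx m) R :=
  Matrix.fromBlocks (diagPart x) (-signMat R m) (skewPart x) (diagPart x)

/-- The Jacobian matrix of the Flaschka map over a commutative ring. -/
def jacMat (x : AIdx m → R) : Matrix (AIdx m) (QPIdx m) R :=
  Matrix.fromBlocks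
    (Matrix.of fun i j =>
      x (Sum.inl i) * ((if j = i.castSucc then 1 else 0) - (if j = i.succ then 1 else 0))) 0 0 1

/-- The canonical Poisson matrix over a commutative ring. -/
def symp (R : Type*) [CommRing R] (m : ℕ) : Matrix (QPIdx m) (QPIdx m) R :=
  Matrix.fromBlocks 0 1 (-1) 0

variable (x : AIdx m → R)

theorem symp_mul_symp : symp R m * symp R m = -1 := by
  rw [← Matrix.fromBlocks_one, Matrix.fromBlocks_neg]
  simp [symp, Matrix.fromBlocks_multiply]

theorem symp_transpose : (symp R m)ᵀ = -symp R m := by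
  simp [symp, Matrix.fromBlocks_transpose, Matrix.fromBlocks_neg]

theorem signMat_transpose : (signMat R m)ᵀ = -signMat R m := by
  ext i j
  simp only [signMat, Matrix.transpose_apply, Matrix.of_apply, Matrix.neg_apply]
  split_ifs <;> first | omega | simp

theorem diagPart_transpose : (diagPart x)ᵀ = diagPart x := Matrix.diagonal_transpose _

theorem skewPart_transpose : (skewPart x)ᵀ = -skewPart x := by simp [skewPart]

/-- N is self-adjoint for the symplectic form; this makes every N^a J₁ skew-symmetric. -/
theorem recMat_mul_symp : recMat x * symp R m = symp R m * (recMat x)ᵀ := by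
  simp [recMat, symp, Matrix.fromBlocks_multiply, Matrix.fromBlocks_transpose, signMat_transpose,
    diagPart_transpose, skewPart_transpose]

theorem recMat_pow_mul_symp (a : ℕ) : recMat x ^ a * symp R m = symp R m * (recMat x ^ a)ᵀ := by
  induction a with
  | zero => simp
  | succ a ih =>
    rw [pow_succ', mul_assoc, ih, ← mul_assoc, recMat_mul_symp, mul_assoc, ← Matrix.transpose_mul,
      ← pow_succ, ← pow_succ']

theorem supDiag_apply_eq_zero {i j : Fin (m + 1)} (h : (i : ℕ) + 1 ≠ j) : supDiag x i j = 0 := by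
  simp [supDiag, h]

theorem signMat_neg_apply (i j : Fin (m + 1)) : signMat R m i j = -signMat R m j i := by
  rw [← Matrix.transpose_apply (signMat R m), signMat_transpose, Matrix.neg_apply]

/-- The superdiagonal lives on j = i + 1 and no index lies strictly between i and i + 1, so the
signs of k - i and k - j differ only at k = i and k = j. -/
theorem supDiag_mul_signMat_sub (i j k : Fin (m + 1)) :
    supDiag x i j * (signMat R m k i - signMat R m k j) =
      supDiag x i j * ((if k = i then 1 else 0) + (if k = j then 1 else 0)) := by
  by_cases h : (i : ℕ) + 1 = j
  · congr 1
    simp only [signMat, Matrix.of_apply, Fin.lt_def, Fin.ext_iff]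
    split_ifs <;> first | omega | norm_num
  · rw [supDiag_apply_eq_zero x h, zero_mul, zero_mul]

theorem skewPart_mul_signMat (i j k : Fin (m + 1)) :
    skewPart x i j * (signMat R m i j * (signMat R m k j - signMat R m k i)) =
      skewPart x i j * ((if k = i then 1 else 0) + (if k = j then 1 else 0)) := by
  have hs : ∀ i j : Fin (m + 1), supDiag x i j * signMat R m i j = -supDiag x i j := fun i j => by
    by_cases h : (i : ℕ) + 1 = j
    · have : i < j := by rw [Fin.lt_def]; omega
      simp [signMat, this]
    · simp [supDiag_apply_eq_zero x h]
  have h1 := supDiag_mul_signMat_sub x i j k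
  have h2 := supDiag_mul_signMat_sub x j i k
  rw [skewPart, Matrix.sub_apply, Matrix.transpose_apply]
  linear_combination h2 - h1 + (signMat R m k i - signMat R m k j) * (hs i j + hs j i)
    + (signMat R m k j - signMat R m k i) * supDiag x j i * signMat_neg_apply (R := R) i j

end Generic

/-! ### Polynomial calculus in canonical coordinates: vanishing torsion and closed forms -/

section Poly

open MvPolynomial

variable (m : ℕ)

/-- The ring of polynomial functions on the phase space. -/
abbrev PolyFun (m : ℕ) := MvPolynomial (AIdx m) ℝ

/-- The derivation of polynomials in `a = exp (qᵢ - qᵢ₊₁)`, `b = p` along a canonical coordinate. -/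
noncomputable def canonDeriv (α : QPIdx m) : Derivation ℝ (PolyFun m) (PolyFun m) :=
  mkDerivation ℝ fun i => jacMat (X : AIdx m → PolyFun m) i α

theorem canonDeriv_X (α : QPIdx m) (i : AIdx m) :
    canonDeriv m α (X i) = jacMat (X : AIdx m → PolyFun m) i α := mkDerivation_X _ _ _

theorem canonDeriv_apply (α : QPIdx m) (f : PolyFun m) :
    canonDeriv m α f = ∑ i, jacMat X i α * MvPolynomial.pderiv i f := by
  have : canonDeriv m α =
      ∑ i, jacMat (X : AIdx m → PolyFun m) i α • MvPolynomial.pderiv (R := ℝ) i := by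
    refine MvPolynomial.derivation_ext fun j => ?_
    rw [canonDeriv_X, ← Derivation.coeFnAddMonoidHom_apply, map_sum]
    simp [Finset.sum_apply, Derivation.coeFnAddMonoidHom_apply, pderiv_X, Pi.single_apply]
  rw [this, ← Derivation.coeFnAddMonoidHom_apply, map_sum]
  simp [Finset.sum_apply, Derivation.coeFnAddMonoidHom_apply]

theorem canonDeriv_ite (α : QPIdx m) (p : Prop) [Decidable p] (f g : PolyFun m) :
    canonDeriv m α (if p then f else g) = if p then canonDeriv m α f else canonDeriv m α g := by
  split_ifs <;> rfl

/-- Symmetry of the second derivatives of the Flaschka map, the hypothesis `hF` of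
`jacobiator_pushforward`. -/
theorem canonDeriv_jacMat_comm (j : AIdx m) (α β : QPIdx m) :
    canonDeriv m α (jacMat X j β) = canonDeriv m β (jacMat X j α) := by
  rcases j with j | j <;> rcases α with α | α <;> rcases β with β | β <;>
    simp [jacMat, Derivation.leibniz, canonDeriv_X, Matrix.one_apply, canonDeriv_ite, mul_comm,
      mul_left_comm]

theorem canonDeriv_symp (i j l : QPIdx m) : canonDeriv m l (symp _ m i j) = 0 := by
  rcases i with i | i <;> rcases j with j | j <;> simp [symp, Matrix.one_apply, canonDeriv_ite]

theorem canonDeriv_signMat (i j : Fin (m + 1)) (α : QPIdx m) :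
    canonDeriv m α (signMat _ m i j) = 0 := by
  simp [signMat, canonDeriv_ite]

theorem canonDeriv_subDiag (i j : Fin (m + 1)) (α : QPIdx m) :
    canonDeriv m α (subDiag _ m i j) = 0 := by
  simp [subDiag, canonDeriv_ite]

theorem canonDeriv_diagPart_inl (i j k : Fin (m + 1)) :
    canonDeriv m (Sum.inl k) (diagPart X i j) = 0 := by
  simp [diagPart, Matrix.diagonal_apply, canonDeriv_ite, canonDeriv_X, jacMat]

theorem canonDeriv_diagPart_inr (i j k : Fin (m + 1)) :
    canonDeriv m (Sum.inr k) (diagPart X i j) =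
      if i = j then (if i = k then 1 else 0) else 0 := by
  simp [diagPart, Matrix.diagonal_apply, canonDeriv_ite, canonDeriv_X, jacMat, Matrix.one_apply]

theorem canonDeriv_supDiag_inr (i j k : Fin (m + 1)) :
    canonDeriv m (Sum.inr k) (supDiag X i j) = 0 := by
  by_cases h : (i : ℕ) + 1 = j <;> simp [supDiag, h, canonDeriv_X, jacMat]

theorem canonDeriv_supDiag_inl (i j k : Fin (m + 1)) :
    canonDeriv m (Sum.inl k) (supDiag X i j) =
      supDiag X i j * ((if i = k then 1 else 0) - (if j = k then 1 else 0)) := by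
  by_cases h : (i : ℕ) + 1 = j
  · simp [supDiag, h, canonDeriv_X, jacMat, Fin.ext_iff, eq_comm]
  · simp [supDiag, h]

theorem canonDeriv_skewPart_inl (i j k : Fin (m + 1)) :
    canonDeriv m (Sum.inl k) (skewPart X i j) =
      signMat _ m i j * ((if k = j then 1 else 0) - (if k = i then 1 else 0)) *
        skewPart X i j := by
  have hs : ∀ i j : Fin (m + 1), supDiag (X : _ → PolyFun m) i j * signMat _ m i j = -supDiag X i j :=
    fun i j => by
    by_cases h : (i : ℕ) + 1 = j
    · have : i < j := by rw [Fin.lt_def]; omega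
      simp [signMat, this]
    · simp [supDiag_apply_eq_zero _ h]
  simp only [skewPart, Matrix.sub_apply, Matrix.transpose_apply, map_sub, canonDeriv_supDiag_inl,
    eq_comm (a := k)]
  have h1 := hs i j
  have h2 := hs j i
  rw [signMat_neg_apply] at h2
  simp only [mul_neg] at h2
  linear_combination ((if j = k then 1 else 0) - (if i = k then 1 else 0)) * (h1 + h2)

theorem skewPart_neg_apply (i j : Fin (m + 1)) :
    skewPart (X : _ → PolyFun m) i j = -skewPart X j i := by
  simp [skewPart]

theorem canonDeriv_skewPart_inr (i j k : Fin (m + 1)) :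
    canonDeriv m (Sum.inr k) (skewPart X i j) = 0 := by
  simp [skewPart, canonDeriv_supDiag_inr]

theorem torsion_neg {κ : Type*} [Fintype κ] (D : κ → Derivation ℝ (PolyFun m) (PolyFun m))
    (N : Matrix κ κ (PolyFun m)) (i j k : κ) : torsion D N i j k = -torsion D N j i k := by
  simp only [torsion, ← Finset.sum_neg_distrib]
  exact Finset.sum_congr rfl fun _ _ => by ring

/-- In N the diagonal blocks depend only on p, the block `skewPart` only on q, and the sign block is
constant. By skew-symmetry the pairs (q, q), (q, p), (p, p) suffice. The components (q, q; q) and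
(q, p; p) reduce to `skewPart_mul_signMat`, which matches the logarithmic derivatives of aᵢ with
differences of signs; the others cancel as Kronecker deltas. -/
theorem torsion_recMat (i j k : QPIdx m) :
    torsion (canonDeriv m) (recMat X) i j k = 0 := by
  have hself : ∀ i k, torsion (canonDeriv m) (recMat X) i i k = 0 := fun i k => by
    simp only [torsion]
    exact Finset.sum_eq_zero fun _ _ => by ring
  have hD := fun k i j => canonDeriv_skewPart_inl m i j k
  have hD' := fun k i j => canonDeriv_skewPart_inr m i j k
  have hkey := skewPart_mul_signMat (X : _ → PolyFun m)
  have hqp : ∀ (i j : Fin (m + 1)) (k : QPIdx m),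
      torsion (canonDeriv m) (recMat X) (Sum.inl i) (Sum.inr j) k = 0 := by
    intro i j k
    rcases k with k | k
    · simp only [torsion, Fintype.sum_sum_type, recMat, Matrix.fromBlocks_apply₁₁,
        Matrix.fromBlocks_apply₁₂, Matrix.fromBlocks_apply₂₁, Matrix.fromBlocks_apply₂₂,
        canonDeriv_diagPart_inl, canonDeriv_diagPart_inr, canonDeriv_signMat, hD', Matrix.neg_apply,
        map_neg]
      simp [diagPart, Matrix.diagonal_apply]
      by_cases h1 : k = i
      · simp [h1]
      · simp [h1]
    · simp only [torsion, Fintype.sum_sum_type, recMat, Matrix.fromBlocks_apply₁₁,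
        Matrix.fromBlocks_apply₁₂, Matrix.fromBlocks_apply₂₁, Matrix.fromBlocks_apply₂₂,
        canonDeriv_diagPart_inl, canonDeriv_diagPart_inr, canonDeriv_signMat, hD', hD,
        Matrix.neg_apply, map_neg]
      simp [diagPart, Matrix.diagonal_apply]
      have h := hkey k i j
      simp only [sub_mul, mul_sub, Finset.sum_add_distrib, Finset.sum_sub_distrib, mul_ite, ite_mul,
        mul_one, mul_zero, zero_mul, Finset.sum_ite_eq', Finset.mem_univ, if_true]
      rw [signMat_neg_apply j i, signMat_neg_apply j k] at h
      simp only [eq_comm (a := j)] at h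
      split_ifs at h ⊢ <;> linear_combination -h
  rcases i with i | i <;> rcases j with j | j
  · by_cases hij : i = j
    · rw [hij, hself]
    rcases k with k | k
    · simp only [torsion, Fintype.sum_sum_type, recMat, Matrix.fromBlocks_apply₁₁,
        Matrix.fromBlocks_apply₁₂, Matrix.fromBlocks_apply₂₁, Matrix.fromBlocks_apply₂₂,
        canonDeriv_diagPart_inl, canonDeriv_diagPart_inr, canonDeriv_signMat, hD', hD,
        Matrix.neg_apply, map_neg]
      simp [diagPart, Matrix.diagonal_apply, hij, Ne.symm hij]
      have h := hkey i j k
      simp only [mul_add, mul_ite, mul_neg, Finset.sum_add_distrib, Finset.sum_sub_distrib, mul_zero]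
      simp
      have e1 : (if k = j then skewPart (X : _ → PolyFun m) k i else 0) =
          -(skewPart X i j * if k = j then 1 else 0) := by
        split_ifs with h1
        · rw [h1, skewPart_neg_apply, mul_one]
        · simp
      have e2 : (if k = i then skewPart (X : _ → PolyFun m) k j else 0) =
          skewPart X i j * if k = i then 1 else 0 := by
        split_ifs with h1
        · rw [h1, mul_one]
        · simp
      rw [e1, e2, skewPart_neg_apply m j i, signMat_neg_apply j i]
      linear_combination h
    · simp only [torsion, Fintype.sum_sum_type, recMat, Matrix.fromBlocks_apply₁₁,
        Matrix.fromBlocks_apply₁₂, Matrix.fromBlocks_apply₂₁, Matrix.fromBlocks_apply₂₂,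
        canonDeriv_diagPart_inl, canonDeriv_diagPart_inr, canonDeriv_signMat, hD', hD,
        Matrix.neg_apply, map_neg]
      simp [diagPart, Matrix.diagonal_apply, hij, Ne.symm hij]
      by_cases h1 : i = k
      · have h2 : j ≠ k := fun h => hij (h1.trans h.symm)
        simp [h1, h2]
      · by_cases h2 : j = k <;> simp [h1, h2]
  · exact hqp i j k
  · rw [torsion_neg, hqp, neg_zero]
  · rcases k with k | k
    · simp only [torsion, Fintype.sum_sum_type, recMat, Matrix.fromBlocks_apply₁₁,
        Matrix.fromBlocks_apply₁₂, Matrix.fromBlocks_apply₂₁, Matrix.fromBlocks_apply₂₂,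
        canonDeriv_diagPart_inl, canonDeriv_diagPart_inr, canonDeriv_signMat, hD', hD,
        Matrix.neg_apply, map_neg]
      simp [diagPart, Matrix.diagonal_apply]
      refine Finset.sum_eq_zero fun x _ => ?_
      by_cases h1 : x = i <;> by_cases h2 : x = j <;> simp_all
    · simp only [torsion, Fintype.sum_sum_type, recMat, Matrix.fromBlocks_apply₁₁,
        Matrix.fromBlocks_apply₁₂, Matrix.fromBlocks_apply₂₁, Matrix.fromBlocks_apply₂₂,
        canonDeriv_diagPart_inl, canonDeriv_diagPart_inr, canonDeriv_signMat, hD', hD,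
        Matrix.neg_apply, map_neg]
      simp [diagPart, Matrix.diagonal_apply]
      by_cases h1 : k = i <;> by_cases h2 : k = j <;> simp_all

theorem extDeriv₂_symp (i j k : QPIdx m) : extDeriv₂ (canonDeriv m) (-symp _ m) i j k = 0 := by
  simp [extDeriv₂, canonDeriv_symp]

/-- The form J₁⁻¹ N is the sum of three closed pieces: ∑ aᵢ dqᵢ ∧ dqᵢ₊₁, closed since daᵢ = aᵢ (dqᵢ
- dqᵢ₊₁); a multiple of ∑ pᵢ dqᵢ ∧ dpᵢ; and a form in the dpᵢ with constant coefficients. -/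
theorem extDeriv₂_symp_mul_recMat (i j k : QPIdx m) :
    extDeriv₂ (canonDeriv m) (-symp _ m * recMat X) i j k = 0 := by
  have : -symp (PolyFun m) m * recMat X = Matrix.fromBlocks (-skewPart X)
      (-diagPart X) (diagPart X) (-signMat _ m) := by
    simp [recMat, symp, Matrix.fromBlocks_multiply, Matrix.fromBlocks_neg]
  have hD := fun k i j => canonDeriv_skewPart_inl m i j k
  have hD' := fun k i j => canonDeriv_skewPart_inr m i j k
  rw [this]
  rcases i with i | i <;> rcases j with j | j <;> rcases k with k | k <;>
    simp only [extDeriv₂, Matrix.fromBlocks_apply₁₁,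
        Matrix.fromBlocks_apply₁₂, Matrix.fromBlocks_apply₂₁, Matrix.fromBlocks_apply₂₂,
        canonDeriv_diagPart_inl, canonDeriv_diagPart_inr, canonDeriv_signMat, hD', hD,
        Matrix.neg_apply, map_neg]
  · by_cases h1 : i = j
    · subst h1
      simp [signMat_neg_apply k i, skewPart_neg_apply m k i]
      ring
    by_cases h2 : j = k
    · subst h2
      simp [Ne.symm h1, skewPart_neg_apply m j i, signMat_neg_apply j i]
    · by_cases h3 : i = k
      · subst h3
        simp [h1, Ne.symm h1, skewPart_neg_apply m j i, signMat_neg_apply j i]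
      · simp [Ne.symm h1, Ne.symm h2, h3, Ne.symm h3, h1, h2]
  all_goals simp
  all_goals simp only [Fin.ext_iff]
  all_goals split_ifs <;> first | omega | norm_num

end Poly

/-! ### Jacobi identity of the Toda tensors and the Lenard relations, as polynomial identities -/

section Hierarchy

open MvPolynomial

variable (m : ℕ)

local notation "Lₓ" => laxMat (MvPolynomial.X : AIdx m → PolyFun m)
local notation "Uₓ" => supDiag (MvPolynomial.X : AIdx m → PolyFun m)

theorem recMat_pow_transpose_mul_symp {R : Type*} [CommRing R] (x : AIdx m → R) (a : ℕ) :
    (recMat x ^ a)ᵀ * symp R m = symp R m * recMat x ^ a := by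
  have h := congrArg (fun A => symp R m * A * symp R m) (recMat_pow_mul_symp x a)
  simp only [mul_assoc, symp_mul_symp] at h
  rw [← mul_assoc (symp R m) (symp R m), symp_mul_symp] at h
  simpa using h.symm

theorem jacobiator_recMat_pow_mul_symp (a : ℕ) (i j k : QPIdx m) :
    jacobiator (canonDeriv m) (recMat X ^ a * symp _ m) i j k = 0 := by
  have hN : (recMat (X : _ → PolyFun m))ᵀ * -symp _ m = -symp _ m * recMat X := by
    have := recMat_pow_transpose_mul_symp m (X : _ → PolyFun m) 1
    simpa using this
  have hW : (-symp (PolyFun m) m)ᵀ = -(-symp _ m) := by rw [Matrix.transpose_neg, symp_transpose]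
  refine jacobiator_of_closed (canonDeriv m) (recMat X ^ a) (symp _ m) (-symp _ m * recMat X ^ a)
    (canonDeriv_symp m) symp_transpose ?_ ?_ (recMat_pow_mul_symp _ a)
    (torsion_pow _ _ (torsion_recMat m) a)
    (closed_mul_pow _ _ _ hW hN (torsion_recMat m) (extDeriv₂_symp m)
      (extDeriv₂_symp_mul_recMat m) a) i j k
  · rw [← mul_assoc, mul_neg, symp_mul_symp, neg_neg, one_mul]
  · rw [Matrix.transpose_mul, hW, neg_neg, recMat_pow_transpose_mul_symp, neg_mul, neg_neg]

/-- The Toda tensor over a commutative ring. -/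
def tensorMat {R : Type*} [CommRing R] (k : ℕ) (x : AIdx m → R) : Matrix (AIdx m) (AIdx m) R :=
  jacMat x * (recMat x ^ (k - 1) * symp R m) * (jacMat x)ᵀ

theorem recMat_pow_mul_symp_transpose {R : Type*} [CommRing R] (x : AIdx m → R) (a : ℕ) :
    (recMat x ^ a * symp R m)ᵀ = -(recMat x ^ a * symp R m) := by
  rw [Matrix.transpose_mul, symp_transpose, neg_mul, recMat_pow_mul_symp]

theorem tensorMat_transpose {R : Type*} [CommRing R] (k : ℕ) (x : AIdx m → R) :
    (tensorMat m k x)ᵀ = -tensorMat m k x := by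
  rw [tensorMat, Matrix.transpose_mul, Matrix.transpose_mul, Matrix.transpose_transpose,
    recMat_pow_mul_symp_transpose, Matrix.neg_mul, Matrix.mul_neg, ← Matrix.mul_assoc (jacMat x)]

/-- By the chain rule `canonDeriv_apply`, differentiating along a row of F N^(k-1) J₁, with F the
Flaschka Jacobian, is differentiating in (a, b) along a row of the tensor. So the pushed-forward
identity is the Jacobi identity in (a, b). -/
theorem tensorMat_jacobi (k : ℕ) (i j l : AIdx m) :
    ∑ s, (tensorMat m k X i s * MvPolynomial.pderiv s (tensorMat m k (X : _ → PolyFun m) j l)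
      + tensorMat m k X j s * MvPolynomial.pderiv s (tensorMat m k (X : _ → PolyFun m) l i)
      + tensorMat m k X l s * MvPolynomial.pderiv s (tensorMat m k (X : _ → PolyFun m) i j)) = 0 := by
  set P := recMat (X : _ → PolyFun m) ^ (k - 1) * symp _ m with hP
  have hd : ∀ i (f : PolyFun m), dirDeriv (canonDeriv m) ((jacMat (X : _ → PolyFun m) * P) i) f =
      ∑ s, tensorMat m k X i s * MvPolynomial.pderiv s f := fun i f => by
    simp only [dirDeriv_apply, canonDeriv_apply, tensorMat, ← hP, Matrix.mul_apply (N := (jacMat X)ᵀ),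
      Matrix.transpose_apply, Finset.mul_sum, Finset.sum_mul]
    rw [Finset.sum_comm]
    simp only [mul_assoc]
  have := jacobiator_pushforward (canonDeriv m) P (jacMat X)
    (recMat_pow_mul_symp_transpose m X _) (canonDeriv_jacMat_comm m)
    (jacobiator_recMat_pow_mul_symp m _) i j l
  simp only [hd] at this
  rw [Finset.sum_add_distrib, Finset.sum_add_distrib]
  exact this

/-- The diagonal matrix which symmetrizes the generic Lax matrix. -/
noncomputable def symmetrizer : Matrix (Fin (m + 1)) (Fin (m + 1)) (PolyFun m) :=
  Matrix.diagonal fun i => ∏ r : Fin m, if (i : ℕ) ≤ r then X (Sum.inl r) else 1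

/-- The reason for working with generic coordinates: at a real point some aᵢ may vanish, whereas in
the polynomial ring these products can be cancelled. -/
theorem symmetrizer_apply_self_ne_zero (i : Fin (m + 1)) : symmetrizer m i i ≠ 0 := by
  rw [symmetrizer, Matrix.diagonal_apply_eq, Finset.prod_ne_zero_iff]
  intro r _
  split_ifs
  · exact X_ne_zero _
  · exact one_ne_zero

theorem subDiag_mul_symmetrizer :
    subDiag (PolyFun m) m * symmetrizer m = symmetrizer m * Uₓᵀ := by
  ext i j
  rw [symmetrizer, Matrix.mul_diagonal, Matrix.diagonal_mul, Matrix.transpose_apply]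
  by_cases h : (j : ℕ) + 1 = i
  · have hj : (j : ℕ) < m := by omega
    have : (X (Sum.inl ⟨j, hj⟩) : PolyFun m) =
        ∏ r : Fin m, if r = ⟨j, hj⟩ then X (Sum.inl r) else 1 := by simp
    simp only [subDiag, supDiag, Matrix.of_apply, h, if_true, dif_pos, one_mul]
    rw [this, ← Finset.prod_mul_distrib]
    refine congrArg _ (Finset.prod_congr rfl fun r _ => ?_)
    simp only [Fin.ext_iff]
    split_ifs <;> first | omega | simp
  · simp [subDiag, supDiag, h]

theorem laxMat_pow_mul_symmetrizer (s : ℕ) :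
    Lₓ ^ s * symmetrizer m = symmetrizer m * (Lₓ ^ s)ᵀ := by
  have h1 : Uₓ * symmetrizer m = symmetrizer m * (subDiag (PolyFun m) m)ᵀ := by
    have := congrArg Matrix.transpose (subDiag_mul_symmetrizer m)
    rw [Matrix.transpose_mul, Matrix.transpose_mul, Matrix.transpose_transpose, symmetrizer,
      Matrix.diagonal_transpose] at this
    exact this.symm
  have h2 : diagPart X * symmetrizer m = symmetrizer m * diagPart X := by
    rw [diagPart, symmetrizer, Matrix.diagonal_mul_diagonal, Matrix.diagonal_mul_diagonal]
    simp only [mul_comm]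
  have h3 : Lₓ * symmetrizer m = symmetrizer m * Lₓᵀ := by
    simp only [laxMat, add_mul, h1, h2, subDiag_mul_symmetrizer, Matrix.transpose_add, mul_add,
      diagPart_transpose]
    abel
  induction s with
  | zero => simp
  | succ s ih =>
    rw [pow_succ, mul_assoc, h3, ← mul_assoc, ih, mul_assoc, ← Matrix.transpose_mul, ← pow_succ',
      ← pow_succ]

/-- With L = U + B + V split into upper, diagonal and lower parts and g the symmetrizer, V g = g Uᵀ
and L^s g = g (L^s)ᵀ. Hence V L^s g = g (L^s U)ᵀ; compare diagonal entries and cancel gᵢ. -/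
theorem subDiag_mul_laxMat_pow_diag (s : ℕ) (i : Fin (m + 1)) :
    (subDiag (PolyFun m) m * Lₓ ^ s) i i = (Lₓ ^ s * Uₓ) i i := by
  have h : subDiag (PolyFun m) m * Lₓ ^ s * symmetrizer m =
      symmetrizer m * (Lₓ ^ s * Uₓ)ᵀ := by
    rw [mul_assoc, laxMat_pow_mul_symmetrizer, ← mul_assoc, subDiag_mul_symmetrizer,
      Matrix.transpose_mul, mul_assoc]
  have := congrFun₂ h i i
  have hg := symmetrizer_apply_self_ne_zero m i
  rw [symmetrizer, Matrix.diagonal_apply_eq] at hg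
  rw [symmetrizer, Matrix.mul_diagonal, Matrix.diagonal_mul, mul_comm] at this
  exact mul_left_cancel₀ hg this

theorem laxMat_pow_mul_subDiag_diag (s : ℕ) (i : Fin (m + 1)) :
    (Lₓ ^ s * subDiag (PolyFun m) m) i i = (Uₓ * Lₓ ^ s) i i := by
  have h : Lₓ ^ s * subDiag (PolyFun m) m * symmetrizer m =
      symmetrizer m * (Uₓ * Lₓ ^ s)ᵀ := by
    rw [mul_assoc, subDiag_mul_symmetrizer, ← mul_assoc, laxMat_pow_mul_symmetrizer,
      Matrix.transpose_mul, mul_assoc]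
  have := congrFun₂ h i i
  have hg := symmetrizer_apply_self_ne_zero m i
  rw [symmetrizer, Matrix.diagonal_apply_eq] at hg
  rw [symmetrizer, Matrix.mul_diagonal, Matrix.diagonal_mul, mul_comm] at this
  exact mul_left_cancel₀ hg this

/-- The Hamiltonian `(1/j) tr L^j` as a polynomial. -/
noncomputable def hamPoly (j : ℕ) : PolyFun m := C (1 / (j : ℝ)) * (Lₓ ^ j).trace

theorem canonDeriv_hamPoly (l : ℕ) (α : QPIdx m) :
    canonDeriv m α (hamPoly m (l + 1)) =
      (Lₓ ^ l * (Lₓ).map (canonDeriv m α)).trace := by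
  rw [hamPoly, Derivation.leibniz, ← MvPolynomial.algebraMap_eq, Derivation.map_algebraMap,
    derivation_trace_pow, MvPolynomial.algebraMap_eq, smul_zero, add_zero, smul_eq_mul,
    ← mul_assoc]
  have : C (1 / ((l + 1 : ℕ) : ℝ)) * ((l : PolyFun m) + 1) = 1 := by
    have h : ((l : PolyFun m) + 1) = C ((l + 1 : ℕ) : ℝ) := by simp
    rw [h, ← C_mul, one_div_mul_cancel (by positivity), C_1]
  rw [this, one_mul]

theorem canonDeriv_inr_hamPoly (l : ℕ) (i : Fin (m + 1)) :
    canonDeriv m (Sum.inr i) (hamPoly m (l + 1)) = (Lₓ ^ l) i i := by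
  rw [canonDeriv_hamPoly]
  have : (Lₓ).map (canonDeriv m (Sum.inr i)) = Matrix.single i i 1 := by
    ext a b
    simp only [laxMat, Matrix.map_apply, Matrix.add_apply, map_add, canonDeriv_supDiag_inr,
      canonDeriv_subDiag, canonDeriv_diagPart_inr, Matrix.single_apply]
    by_cases h1 : a = b <;> by_cases h2 : a = i <;> simp_all [eq_comm]
  simp [this, Matrix.trace_mul_single]

theorem canonDeriv_inl_hamPoly (l : ℕ) (i : Fin (m + 1)) :
    canonDeriv m (Sum.inl i) (hamPoly m (l + 1)) =
      (Uₓ * Lₓ ^ l) i i - (Lₓ ^ l * Uₓ) i i := by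
  rw [canonDeriv_hamPoly]
  simp only [laxMat, Matrix.trace, Matrix.diag_apply, Matrix.mul_apply, Matrix.map_apply,
    Matrix.add_apply, map_add, canonDeriv_supDiag_inl, canonDeriv_subDiag, canonDeriv_diagPart_inl]
  simp [mul_sub, Finset.sum_sub_distrib, mul_comm]

theorem symp_mulVec_grad (l : ℕ) :
    symp _ m *ᵥ (fun α => canonDeriv m α (hamPoly m (l + 1))) =
      Sum.elim (fun i => (Lₓ ^ l) i i)
        (fun i => (Lₓ ^ l * Uₓ) i i - (Uₓ * Lₓ ^ l) i i) := by
  have : (fun α => canonDeriv m α (hamPoly m (l + 1))) =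
      Sum.elim (fun i => canonDeriv m (Sum.inl i) (hamPoly m (l + 1)))
        (fun i => canonDeriv m (Sum.inr i) (hamPoly m (l + 1))) := by
    ext (i | i) <;> rfl
  rw [this, symp, Matrix.fromBlocks_mulVec]
  ext (i | i) : 1 <;>
    simp [canonDeriv_inr_hamPoly, canonDeriv_inl_hamPoly, Matrix.neg_mulVec]

/-- Regrouping the sum by entries of U produces differences of signs, which
`supDiag_mul_signMat_sub` localizes at i. -/
theorem signMat_mulVec_diag {R : Type*} [CommRing R] (x : AIdx m → R)
    (M : Matrix (Fin (m + 1)) (Fin (m + 1)) R) (i : Fin (m + 1)) :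
    ∑ j, signMat R m i j * ((supDiag x * M) j j - (M * supDiag x) j j) =
      (supDiag x * M) i i + (M * supDiag x) i i := by
  have h1 : ∑ j, signMat R m i j * ((supDiag x * M) j j - (M * supDiag x) j j) =
      ∑ j, ∑ r, supDiag x j r * (signMat R m i j - signMat R m i r) * M r j := by
    simp only [mul_sub, sub_mul, Finset.sum_sub_distrib, Matrix.mul_apply, Finset.mul_sum]
    congr 1
    · exact Finset.sum_congr rfl fun _ _ => Finset.sum_congr rfl fun _ _ => by ring
    · rw [Finset.sum_comm]
      exact Finset.sum_congr rfl fun _ _ => Finset.sum_congr rfl fun _ _ => by ring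
  rw [h1]
  simp only [supDiag_mul_signMat_sub, mul_add, add_mul, Finset.sum_add_distrib]
  simp [Matrix.mul_apply, mul_comm]

theorem supDiag_mul_mul_subDiag_diag {R : Type*} [CommRing R] (x : AIdx m → R)
    (M : Matrix (Fin (m + 1)) (Fin (m + 1)) R) (i : Fin (m + 1)) :
    (supDiag x * M * subDiag R m) i i = ∑ r, supDiag x i r * M r r := by
  simp only [Matrix.mul_apply, Finset.sum_mul]
  rw [Finset.sum_comm]
  refine Finset.sum_congr rfl fun r _ => ?_
  rw [Finset.sum_eq_single r]
  · by_cases h : (i : ℕ) + 1 = r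
    · simp [subDiag, h]
    · simp [supDiag_apply_eq_zero x h]
  · intro b _ hb
    by_cases h : (i : ℕ) + 1 = r
    · have : ¬ (i : ℕ) + 1 = b := fun h' => hb (Fin.ext (h'.symm.trans h))
      simp [subDiag, this]
    · simp [supDiag_apply_eq_zero x h]
  · simp

theorem subDiag_mul_mul_supDiag_diag {R : Type*} [CommRing R] (x : AIdx m → R)
    (M : Matrix (Fin (m + 1)) (Fin (m + 1)) R) (i : Fin (m + 1)) :
    (subDiag R m * M * supDiag x) i i = ∑ r, supDiag x r i * M r r := by
  simp only [Matrix.mul_apply, Finset.sum_mul]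
  refine Finset.sum_congr rfl fun r _ => ?_
  rw [Finset.sum_eq_single r]
  · by_cases h : (r : ℕ) + 1 = i
    · simp [subDiag, h, mul_comm]
    · simp [supDiag_apply_eq_zero x h]
  · intro b _ hb
    by_cases h : (r : ℕ) + 1 = i
    · have : ¬ (b : ℕ) + 1 = i := fun h' => hb (Fin.ext (by omega))
      simp [subDiag, this]
    · simp [supDiag_apply_eq_zero x h]
  · simp

/-- The Lenard relation. Write M = L^l. The q-components match after expanding L M, summing the
signs, and using (V M)ᵢᵢ = (M U)ᵢᵢ. In the p-components the terms with V only see diagonal entries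
of M and reproduce the action of `skewPart`. -/
theorem recMat_mulVec_symp_mulVec_grad (l : ℕ) :
    recMat X *ᵥ (symp _ m *ᵥ (fun α => canonDeriv m α (hamPoly m (l + 1)))) =
      symp _ m *ᵥ (fun α => canonDeriv m α (hamPoly m (l + 2))) := by
  rw [symp_mulVec_grad, symp_mulVec_grad, recMat, Matrix.fromBlocks_mulVec]
  set M := Lₓ ^ l with hM
  ext (i | i) : 1
  · have h := signMat_mulVec_diag m X M i
    have hs := subDiag_mul_laxMat_pow_diag m l i
    rw [← hM] at hs
    have hL : (Lₓ ^ (l + 1)) i i =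
        (Uₓ * M) i i + diagPart X i i * M i i + (subDiag (PolyFun m) m * M) i i := by
      rw [pow_succ', ← hM, laxMat, add_mul, add_mul, Matrix.add_apply, Matrix.add_apply, diagPart,
        Matrix.diagonal_mul, Matrix.diagonal_apply_eq]
    simp only [Sum.elim_inl, Sum.elim_comp_inl, Sum.elim_comp_inr, Pi.add_apply, hL, hs,
      Matrix.neg_mulVec, Pi.neg_apply]
    have h1 : (diagPart X *ᵥ fun i => M i i) i = diagPart X i i * M i i := by
      simp [diagPart, Matrix.mulVec_diagonal]
    have h2 : (signMat _ m *ᵥ fun i => (M * Uₓ) i i - (Uₓ * M) i i) i =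
        -∑ j, signMat _ m i j * ((Uₓ * M) j j - (M * Uₓ) j j) := by
      rw [Matrix.mulVec, dotProduct, ← Finset.sum_neg_distrib]
      exact Finset.sum_congr rfl fun _ _ => by ring
    rw [h1, h2, h]
    ring
  · have e1 : (Lₓ ^ (l + 1) * Uₓ) i i = (Uₓ * M * Uₓ) i i
        + diagPart X i i * (M * Uₓ) i i + (subDiag (PolyFun m) m * M * Uₓ) i i := by
      rw [pow_succ', ← hM, laxMat, add_mul, add_mul, add_mul, add_mul, Matrix.add_apply,
        Matrix.add_apply, diagPart, mul_assoc (Matrix.diagonal _),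
        Matrix.diagonal_mul, Matrix.diagonal_apply_eq]
    have e2 : (Uₓ * Lₓ ^ (l + 1)) i i = (Uₓ * M * Uₓ) i i
        + diagPart X i i * (Uₓ * M) i i + (Uₓ * M * subDiag (PolyFun m) m) i i := by
      rw [pow_succ, ← hM, laxMat, ← mul_assoc, mul_add, mul_add, Matrix.add_apply,
        Matrix.add_apply, diagPart,
        Matrix.mul_diagonal, Matrix.diagonal_apply_eq, mul_comm ((Uₓ * M) i i)]
    have h1 : ∀ v : Fin (m + 1) → PolyFun m, (diagPart X *ᵥ v) i = diagPart X i i * v i := by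
      simp [diagPart, Matrix.mulVec_diagonal]
    have h2 : (skewPart X *ᵥ fun i => M i i) i =
        ∑ r, Uₓ r i * M r r - ∑ r, Uₓ i r * M r r := by
      simp [skewPart, Matrix.mulVec, dotProduct, sub_mul, Finset.sum_sub_distrib]
    simp only [Sum.elim_inr, Sum.elim_comp_inl, Sum.elim_comp_inr, Pi.add_apply, h1, h2, e1, e2,
      subDiag_mul_mul_supDiag_diag, supDiag_mul_mul_subDiag_diag]
    ring

theorem jacMat_transpose_mulVec_pderiv (f : PolyFun m) :
    (jacMat X)ᵀ *ᵥ (fun i => MvPolynomial.pderiv i f) = fun α => canonDeriv m α f := by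
  ext1 α
  simp [Matrix.mulVec, dotProduct, canonDeriv_apply]

/-- Each factor N is traded for one degree of the Hamiltonian, so only k + l enters. This is the
source of both the recursion and the common flows. -/
theorem tensorMat_mulVec_grad (k l : ℕ) :
    tensorMat m (k + 1) X *ᵥ (fun i => MvPolynomial.pderiv i (hamPoly m (l + 1))) =
      jacMat X *ᵥ Sum.elim (fun i => (Lₓ ^ (k + l)) i i)
        (fun i => (Lₓ ^ (k + l) * Uₓ) i i - (Uₓ * Lₓ ^ (k + l)) i i) := by
  rw [tensorMat, ← Matrix.mulVec_mulVec, jacMat_transpose_mulVec_pderiv, ← Matrix.mulVec_mulVec,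
    ← symp_mulVec_grad, ← Matrix.mulVec_mulVec, Nat.add_sub_cancel]
  congr 1
  induction k with
  | zero => simp
  | succ k ih =>
    rw [pow_succ', ← Matrix.mulVec_mulVec, ih, recMat_mulVec_symp_mulVec_grad,
      show k + 1 + l + 1 = k + l + 2 by ring]

end Hierarchy

/-! ### Base change of the matrices along ring homomorphisms -/

section RingHom

variable {R S : Type*} [CommRing R] [CommRing S] {m : ℕ} (f : R →+* S) (x : AIdx m → R)

theorem map_supDiag : (supDiag x).map f = supDiag (f ∘ x) := by
  ext i j
  by_cases h : (i : ℕ) + 1 = j <;> simp [supDiag, h]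

theorem map_subDiag : (subDiag R m).map f = subDiag S m := by
  ext i j
  by_cases h : (j : ℕ) + 1 = i <;> simp [subDiag, h]

theorem map_diagPart : (diagPart x).map f = diagPart (f ∘ x) := by
  rw [diagPart, Matrix.diagonal_map (map_zero f)]
  rfl

theorem map_signMat : (signMat R m).map f = signMat S m := by
  ext i j
  simp only [signMat, Matrix.map_apply, Matrix.of_apply]
  split_ifs <;> simp

theorem map_laxMat : (laxMat x).map f = laxMat (f ∘ x) := by
  rw [laxMat, Matrix.map_add _ (map_add f), Matrix.map_add _ (map_add f), map_supDiag, map_subDiag,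
    map_diagPart, laxMat]

theorem map_recMat : (recMat x).map f = recMat (f ∘ x) := by
  rw [recMat, Matrix.fromBlocks_map, map_diagPart, skewPart, Matrix.map_sub _ (map_sub f),
    Matrix.transpose_map, map_supDiag, Matrix.map_neg _ (map_neg f), map_signMat, recMat, skewPart]

theorem map_jacMat : (jacMat x).map f = jacMat (f ∘ x) := by
  rw [jacMat, Matrix.fromBlocks_map, jacMat]
  congr 1
  · ext i j
    simp only [Matrix.map_apply, Matrix.of_apply, map_mul, map_sub, Function.comp_apply]
    split_ifs <;> simp
  · simp
  · simp
  · simp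

theorem map_symp : (symp R m).map f = symp S m := by
  rw [symp, Matrix.fromBlocks_map, Matrix.map_neg _ (map_neg f)]
  simp [symp]

theorem map_tensorMat (k : ℕ) : (tensorMat m k x).map f = tensorMat m k (f ∘ x) := by
  rw [tensorMat, Matrix.map_mul, Matrix.map_mul, Matrix.map_mul, Matrix.map_pow, map_symp,
    Matrix.transpose_map, map_jacMat, map_recMat, tensorMat]

end RingHom

/-! ### Agreement with the definitions at real points -/

section RealPoints

variable {m : ℕ} (x : AIdx m → ℝ)

theorem supDiag_apply_eq_aCoord (i j : Fin (m + 1)) :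
    supDiag x i j = if (i : ℕ) + 1 = j then aCoord x i else 0 := by
  by_cases h : (i : ℕ) + 1 = j
  · have : (i : ℕ) < m := by omega
    simp [supDiag, aCoord, h, this]
  · simp [supDiag, h]

theorem lax_eq_laxMat : lax x = laxMat x := by
  ext i j
  simp only [lax, laxMat, Matrix.of_apply, Matrix.add_apply, supDiag_apply_eq_aCoord, diagPart,
    Matrix.diagonal_apply, subDiag, Fin.ext_iff]
  split_ifs <;> first | omega | simp

theorem J₁_eq_symp : J₁ m = symp ℝ m := rfl

theorem flaschkaJac_eq_jacMat : flaschkaJac x = jacMat x := by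
  rw [flaschkaJac, jacMat]
  congr 1
  ext i j
  simp only [aJac, Matrix.of_apply, Fin.ext_iff, Fin.val_castSucc, Fin.val_succ]
  split_ifs <;> first | omega | simp

theorem recursionOp_eq_recMat : recursionOp x = recMat x := by
  rw [recursionOp, J₂, J₁inv, Matrix.fromBlocks_multiply, recMat]
  congr 1
  · simp [diagPart]
  · simp [signMat]
  · ext i j
    simp only [skewPart, Matrix.mul_zero, Matrix.mul_one, zero_add, Matrix.of_apply, Matrix.sub_apply,
      Matrix.transpose_apply, supDiag_apply_eq_aCoord]
    split_ifs <;> first | omega | simp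
  · simp [diagPart]

theorem todaTensor_eq_tensorMat (k : ℕ) : todaTensor m k x = tensorMat m k x := by
  rw [todaTensor, tensorMat, flaschkaJac_eq_jacMat, recursionOp_eq_recMat, J₁_eq_symp]

end RealPoints

/-! ### Polynomial functions: smoothness and partial derivatives -/

section Evaluation

variable {ι : Type*} [Fintype ι] [DecidableEq ι]

theorem contDiff_eval (p : MvPolynomial ι ℝ) :
    ContDiff ℝ ∞ (fun x : ι → ℝ => MvPolynomial.eval x p) := by
  induction p using MvPolynomial.induction_on with
  | C a => simpa using contDiff_const
  | add p q hp hq => simpa using hp.add hq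
  | mul_X p i hp => simpa using hp.mul (contDiff_apply ℝ ℝ i)

theorem differentiable_eval (p : MvPolynomial ι ℝ) :
    Differentiable ℝ (fun x : ι → ℝ => MvPolynomial.eval x p) :=
  (contDiff_eval p).differentiable (by simp)

theorem pderiv_eval (p : MvPolynomial ι ℝ) (i : ι) (x : ι → ℝ) :
    pderiv i (fun x => MvPolynomial.eval x p) x = MvPolynomial.eval x (MvPolynomial.pderiv i p) := by
  induction p using MvPolynomial.induction_on with
  | C a => simp [pderiv]
  | add p q hp hq =>
    have : (fun x : ι → ℝ => MvPolynomial.eval x (p + q)) =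
        (fun x => MvPolynomial.eval x p) + fun x => MvPolynomial.eval x q := by ext; simp
    rw [pderiv, this, fderiv_add (differentiable_eval p x) (differentiable_eval q x),
      add_apply]
    simp only [pderiv] at hp hq
    rw [hp, hq, map_add, map_add]
  | mul_X p j hp =>
    have : (fun x : ι → ℝ => MvPolynomial.eval x (p * MvPolynomial.X j)) =
        (fun x => MvPolynomial.eval x p) * fun x => x j := by ext; simp
    have hj : fderiv ℝ (fun x : ι → ℝ => x j) x = ContinuousLinearMap.proj j :=
      (ContinuousLinearMap.proj (R := ℝ) (φ := fun _ : ι => ℝ) j).fderiv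
    rw [pderiv, this, fderiv_mul (differentiable_eval p x) (differentiable_apply j x), hj]
    simp only [pderiv] at hp
    simp [hp, Pi.single_apply, MvPolynomial.pderiv_X, apply_ite]

end Evaluation

/-! ### The real A_m-hierarchy: Poisson tensors, Hamiltonian fields and Lax equation -/

section Real

variable {m : ℕ}

theorem todaTensor_apply_eq_eval (k : ℕ) (i j : AIdx m) (x : AIdx m → ℝ) :
    todaTensor m k x i j = MvPolynomial.eval x (tensorMat m k MvPolynomial.X i j) := by
  rw [todaTensor_eq_tensorMat, ← Matrix.map_apply (f := MvPolynomial.eval x), map_tensorMat]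
  congr
  ext i
  simp

theorem todaTensor_transpose (k : ℕ) (x : AIdx m → ℝ) :
    (todaTensor m k x)ᵀ = -todaTensor m k x := by
  rw [todaTensor_eq_tensorMat, tensorMat_transpose]

theorem isPoissonTensor_todaTensor (k : ℕ) : IsPoissonTensor (todaTensor m k) where
  smooth i j := by
    simp only [todaTensor_apply_eq_eval]
    exact contDiff_eval _
  skew x i j := by
    rw [← Matrix.transpose_apply (todaTensor m k x), todaTensor_transpose]
    simp
  jacobi x i j l := by
    simp only [todaTensor_apply_eq_eval, pderiv_eval]
    have := congrArg (MvPolynomial.eval x) (tensorMat_jacobi m k i j l)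
    simpa using this

/-- The Hamiltonians `(1/j) tr L^j` of the `A_m`-Toda lattice. -/
noncomputable def hamA (j : ℕ) (x : AIdx m → ℝ) : ℝ := (1 / (j : ℝ)) * (lax x ^ j).trace

theorem map_eval_laxMat (x : AIdx m → ℝ) :
    (laxMat (MvPolynomial.X : _ → PolyFun m)).map (MvPolynomial.eval x) = laxMat x := by
  rw [map_laxMat]
  exact congrArg laxMat (funext fun i => by simp)

theorem map_eval_supDiag (x : AIdx m → ℝ) :
    (supDiag (MvPolynomial.X : _ → PolyFun m)).map (MvPolynomial.eval x) = supDiag x := by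
  rw [map_supDiag]
  exact congrArg supDiag (funext fun i => by simp)

theorem hamA_eq_eval (j : ℕ) (x : AIdx m → ℝ) : hamA j x = MvPolynomial.eval x (hamPoly m j) := by
  rw [hamA, hamPoly, map_mul, MvPolynomial.eval_C, lax_eq_laxMat, ← map_eval_laxMat,
    ← Matrix.map_pow]
  simp [Matrix.trace]

theorem subDiag_mul_lax_pow_diag (s : ℕ) (x : AIdx m → ℝ) (i : Fin (m + 1)) :
    (subDiag ℝ m * lax x ^ s) i i = (lax x ^ s * supDiag x) i i := by
  have := congrArg (MvPolynomial.eval x) (subDiag_mul_laxMat_pow_diag m s i)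
  rwa [← Matrix.map_apply (f := MvPolynomial.eval x), ← Matrix.map_apply (f := MvPolynomial.eval x),
    Matrix.map_mul, Matrix.map_mul, Matrix.map_pow, map_eval_laxMat, map_eval_supDiag, map_subDiag,
    ← lax_eq_laxMat] at this

theorem lax_pow_mul_subDiag_diag (s : ℕ) (x : AIdx m → ℝ) (i : Fin (m + 1)) :
    (lax x ^ s * subDiag ℝ m) i i = (supDiag x * lax x ^ s) i i := by
  have := congrArg (MvPolynomial.eval x) (laxMat_pow_mul_subDiag_diag m s i)
  rwa [← Matrix.map_apply (f := MvPolynomial.eval x), ← Matrix.map_apply (f := MvPolynomial.eval x),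
    Matrix.map_mul, Matrix.map_mul, Matrix.map_pow, map_eval_laxMat, map_eval_supDiag, map_subDiag,
    ← lax_eq_laxMat] at this

/-- The vector field of the `A_m`-Toda flow `dL/dt = [L, (L^s)₊]`. -/
noncomputable def todaFlow (s : ℕ) (x : AIdx m → ℝ) : AIdx m → ℝ :=
  Sum.elim
    (fun i => x (Sum.inl i) * ((lax x ^ s) i.castSucc i.castSucc - (lax x ^ s) i.succ i.succ))
    (fun i => (lax x ^ s * supDiag x) i i - (supDiag x * lax x ^ s) i i)

theorem hamVec_todaTensor_hamA (k l : ℕ) (x : AIdx m → ℝ) :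
    hamVec (todaTensor m (k + 1)) (hamA (l + 1)) x = todaFlow (k + l) x := by
  have hH : hamA (m := m) (l + 1) = fun x => MvPolynomial.eval x (hamPoly m (l + 1)) :=
    funext fun x => hamA_eq_eval _ _
  ext i
  have h := congrArg (MvPolynomial.eval x) (congrFun (tensorMat_mulVec_grad m k l) i)
  have h1 : MvPolynomial.eval x ((tensorMat m (k + 1) MvPolynomial.X *ᵥ
      fun i => MvPolynomial.pderiv i (hamPoly m (l + 1))) i) =
      hamVec (todaTensor m (k + 1)) (hamA (l + 1)) x i := by
    simp [hamVec, Matrix.mulVec, dotProduct, hH, pderiv_eval, todaTensor_apply_eq_eval]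
  have hM : ∀ a b, (lax x ^ (k + l)) a b =
      MvPolynomial.eval x ((laxMat MvPolynomial.X ^ (k + l)) a b) := fun a b => by
    rw [lax_eq_laxMat, ← map_eval_laxMat, ← Matrix.map_pow, Matrix.map_apply]
  have hU : ∀ a b, supDiag x a b = MvPolynomial.eval x (supDiag MvPolynomial.X a b) := fun a b => by
    rw [← map_eval_supDiag, Matrix.map_apply]
  rw [← h1, h, jacMat, Matrix.fromBlocks_mulVec]
  rcases i with i | i
  · simp only [todaFlow, Sum.elim_inl, hM, Sum.elim_comp_inl, Matrix.zero_mulVec, add_zero]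
    simp [Matrix.mulVec, dotProduct, mul_sub, sub_mul, Finset.sum_sub_distrib]
  · simp [todaFlow, hM, hU, Matrix.mul_apply]

/-- Below the diagonal [L, M₊] vanishes, for L has a single subdiagonal and M₊ is strictly upper
triangular. Above it, the field equals [M - M₊, L], where M - M₊ is lower triangular, and only the
first superdiagonal survives. On the diagonal only the subdiagonal of L meets M₊, and the
symmetrizer identities exchange it for the superdiagonal. -/
theorem laxField_lax (s : ℕ) (x : AIdx m → ℝ) :
    laxField s (lax x) = supDiag (todaFlow s x) + diagPart (todaFlow s x) := by
  set M := lax x ^ s with hM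
  have hcomm : lax x * M = M * lax x := (Commute.refl _).pow_right s
  have hL : ∀ i j : Fin (m + 1), (i : ℕ) + 1 < j ∨ (j : ℕ) + 1 < i → lax x i j = 0 := by
    intro i j h
    simp only [lax, Matrix.of_apply, Fin.ext_iff]
    split_ifs <;> first | omega | rfl
  have hV : ∀ i j : Fin (m + 1), (j : ℕ) < i → lax x i j = subDiag ℝ m i j := by
    intro i j h
    simp only [lax, subDiag, Matrix.of_apply, Fin.ext_iff]
    split_ifs <;> first | omega | rfl
  have hV0 : ∀ i j : Fin (m + 1), (i : ℕ) ≤ j → subDiag ℝ m i j = 0 := by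
    intro i j h
    simp only [subDiag, Matrix.of_apply]
    split_ifs <;> first | omega | rfl
  -- M = L^s commutes with L, so M₊ can be traded for its complement.
  have hlow : ∀ i j, laxField s (lax x) i j =
      ((M - upperPart M) * lax x) i j - (lax x * (M - upperPart M)) i j := by
    intro i j
    rw [laxField, ← hM, sub_mul, mul_sub, hcomm]
    simp only [Matrix.sub_apply]
    ring
  have hup : ∀ i j : Fin (m + 1), upperPart M i j = if (i : ℕ) < j then M i j else 0 := fun _ _ => rfl
  have hlo : ∀ i j : Fin (m + 1), (M - upperPart M) i j = if (i : ℕ) < j then 0 else M i j := by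
    intro i j
    rw [Matrix.sub_apply, hup]
    split_ifs <;> simp
  ext i j
  rcases lt_trichotomy (i : ℕ) (j : ℕ) with h | h | h
  · rw [hlow, Matrix.mul_apply, Matrix.mul_apply, Matrix.add_apply, diagPart,
      Matrix.diagonal_apply_ne _ (fun h' => by rw [h'] at h; exact lt_irrefl _ h), add_zero]
    rw [Finset.sum_eq_single i, Finset.sum_eq_single j]
    · rw [hlo, hlo, if_neg (lt_irrefl _), if_neg (lt_irrefl _)]
      by_cases h1 : (i : ℕ) + 1 = j
      · have hi : (i : ℕ) < m := by omega
        have e1 : (⟨i, hi⟩ : Fin m).castSucc = i := rfl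
        have e2 : (⟨i, hi⟩ : Fin m).succ = j := Fin.ext h1
        have e3 : lax x i j = x (Sum.inl ⟨i, hi⟩) := by
          simp [lax, Fin.ext_iff, h1, h.ne, aCoord, hi]
        simp only [supDiag, Matrix.of_apply, dif_pos h1, todaFlow, Sum.elim_inl, e1, e2, e3, ← hM]
        ring
      · rw [hL i j (by omega), supDiag_apply_eq_zero _ h1]
        ring
    · intro r _ hr
      have hr' : (r : ℕ) ≠ j := fun h => hr (Fin.ext h)
      rw [hlo]
      split_ifs
      · simp
      · rw [hL i r (by omega), zero_mul]
    · simp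
    · intro r _ hr
      have hr' : (r : ℕ) ≠ i := fun h => hr (Fin.ext h)
      rw [hlo]
      split_ifs
      · simp
      · rw [hL r j (by omega), mul_zero]
    · simp
  · obtain rfl : i = j := Fin.ext h
    have h1 : (lax x * upperPart M) i i = (subDiag ℝ m * M) i i := by
      rw [Matrix.mul_apply, Matrix.mul_apply]
      refine Finset.sum_congr rfl fun r _ => ?_
      rw [hup]
      split_ifs with h'
      · rw [hV _ _ h']
      · rw [hV0 _ _ (by omega), mul_zero, zero_mul]
    have h2 : (upperPart M * lax x) i i = (M * subDiag ℝ m) i i := by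
      rw [Matrix.mul_apply, Matrix.mul_apply]
      refine Finset.sum_congr rfl fun r _ => ?_
      rw [hup]
      split_ifs with h'
      · rw [hV _ _ h']
      · rw [hV0 _ _ (by omega), mul_zero, zero_mul]
    rw [laxField, ← hM, Matrix.sub_apply, h1, h2, hM, subDiag_mul_lax_pow_diag,
      lax_pow_mul_subDiag_diag, Matrix.add_apply, supDiag_apply_eq_zero _ (by omega), diagPart,
      Matrix.diagonal_apply_eq, zero_add]
    rfl
  · rw [laxField, ← hM, Matrix.sub_apply, Matrix.mul_apply, Matrix.mul_apply, Matrix.add_apply,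
      supDiag_apply_eq_zero _ (by omega), diagPart,
      Matrix.diagonal_apply_ne _ (fun h' => by rw [h'] at h; exact lt_irrefl _ h)]
    rw [Finset.sum_eq_zero, Finset.sum_eq_zero]
    · simp
    · intro r _
      rw [hup]
      split_ifs
      · rw [hL r j (by omega), mul_zero]
      · simp
    · intro r _
      rw [hup]
      split_ifs
      · rw [hL i r (by omega), zero_mul]
      · simp

end Real

/-! ### The involution and the parity of the recursion operator -/

section Reversal

/-- The permutation matrix of the reversal of indices. -/
def revMat (N : ℕ) : Matrix (Fin N) (Fin N) ℝ := Matrix.of fun i j => if i.rev = j then 1 else 0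

variable {N : ℕ}

theorem revMat_mul_apply {κ : Type*} (A : Matrix (Fin N) κ ℝ) (i : Fin N) (j : κ) :
    (revMat N * A) i j = A i.rev j := by
  simp [revMat, Matrix.mul_apply]

theorem mul_revMat_apply {κ : Type*} (A : Matrix κ (Fin N) ℝ) (i : κ) (j : Fin N) :
    (A * revMat N) i j = A i j.rev := by
  simp [revMat, Matrix.mul_apply, Fin.rev_eq_iff]

theorem revMat_mul_revMat : revMat N * revMat N = 1 := by
  ext i j
  rw [revMat_mul_apply]
  simp [revMat, Matrix.one_apply]

theorem revMat_transpose : (revMat N)ᵀ = revMat N := by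
  ext i j
  simp only [revMat, Matrix.transpose_apply, Matrix.of_apply]
  exact if_congr (by rw [Fin.rev_eq_iff, eq_comm]) rfl rfl

variable {m : ℕ}

/-- The matrix of the linear involution `invol`. -/
def involMat (m : ℕ) : Matrix (AIdx m) (AIdx m) ℝ :=
  Matrix.fromBlocks (revMat m) 0 0 (-revMat (m + 1))

theorem involMat_mulVec (x : AIdx m → ℝ) : involMat m *ᵥ x = invol x := by
  rw [involMat, Matrix.fromBlocks_mulVec]
  ext (i | i) <;> simp [invol, Matrix.mulVec, dotProduct, revMat]

theorem involMat_transpose : (involMat m)ᵀ = involMat m := by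
  simp [involMat, Matrix.fromBlocks_transpose, revMat_transpose]

theorem involMat_mul_self : involMat m * involMat m = 1 := by
  simp [involMat, Matrix.fromBlocks_multiply, revMat_mul_revMat]

/-- The lift of `invol` to the canonical coordinates. -/
def canonInvol (m : ℕ) : Matrix (QPIdx m) (QPIdx m) ℝ :=
  Matrix.fromBlocks (-revMat (m + 1)) 0 0 (-revMat (m + 1))

theorem canonInvol_transpose : (canonInvol m)ᵀ = canonInvol m := by
  simp [canonInvol, Matrix.fromBlocks_transpose, revMat_transpose]

theorem canonInvol_mul_self : canonInvol m * canonInvol m = 1 := by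
  simp [canonInvol, Matrix.fromBlocks_multiply, revMat_mul_revMat]

theorem canonInvol_mul_symp : canonInvol m * symp ℝ m = symp ℝ m * canonInvol m := by
  simp [canonInvol, symp, Matrix.fromBlocks_multiply]

/-- The map (q, p) ↦ (-rev q, -rev p) covers the involution: -rev q sends qᵢ - qᵢ₊₁ to the
difference with reversed index. -/
theorem involMat_mul_jacMat (x : AIdx m → ℝ) :
    involMat m * jacMat x = jacMat (invol x) * canonInvol m := by
  rw [involMat, jacMat, jacMat, canonInvol, Matrix.fromBlocks_multiply, Matrix.fromBlocks_multiply]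
  simp only [Matrix.mul_zero, Matrix.zero_mul, add_zero, zero_add, Matrix.mul_one, Matrix.one_mul,
    Matrix.mul_neg]
  rw [neg_zero, neg_zero]
  congr 1
  ext i j
  have := i.isLt
  rw [revMat_mul_apply, Matrix.neg_apply, mul_revMat_apply]
  simp only [Matrix.of_apply, invol, Sum.elim_inl, Fin.ext_iff, Fin.val_rev, Fin.val_castSucc,
    Fin.val_succ]
  split_ifs <;> first | omega | ring

theorem supDiag_invol (x : AIdx m → ℝ) (i j : Fin (m + 1)) :
    supDiag (invol x) i j.rev = supDiag x j i.rev := by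
  have := i.isLt
  have := j.isLt
  simp only [supDiag, Matrix.of_apply, Fin.val_rev]
  split_ifs with h1 h2
  · simp only [invol, Sum.elim_inl]
    congr 2
    ext
    simp only [Fin.val_rev]
    omega
  · omega
  · omega
  · rfl

/-- Each block is odd: p changes sign, reversal flips the order of indices and hence the sign
matrix, and it exchanges the superdiagonal with its transpose inside `skewPart`. -/
theorem canonInvol_mul_recMat (x : AIdx m → ℝ) :
    canonInvol m * recMat x = -(recMat (invol x) * canonInvol m) := by
  have hB : revMat (m + 1) * diagPart x = -(diagPart (invol x) * revMat (m + 1)) := by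
    ext i j
    rw [revMat_mul_apply, Matrix.neg_apply, mul_revMat_apply]
    simp only [diagPart, Matrix.diagonal_apply, invol, Sum.elim_inr, Fin.rev_eq_iff]
    split_ifs <;> simp
  have hS : revMat (m + 1) * signMat ℝ m = -(signMat ℝ m * revMat (m + 1)) := by
    ext i j
    have := i.isLt
    have := j.isLt
    rw [revMat_mul_apply, Matrix.neg_apply, mul_revMat_apply]
    simp only [signMat, Matrix.of_apply, Fin.lt_def, Fin.val_rev]
    split_ifs <;> first | omega | simp
  have hA : revMat (m + 1) * skewPart x = -(skewPart (invol x) * revMat (m + 1)) := by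
    ext i j
    rw [revMat_mul_apply, Matrix.neg_apply, mul_revMat_apply]
    have h := supDiag_invol x j.rev i.rev
    rw [Fin.rev_rev, Fin.rev_rev] at h
    simp only [skewPart, Matrix.sub_apply, Matrix.transpose_apply, supDiag_invol, h]
    ring
  rw [canonInvol, recMat, recMat, Matrix.fromBlocks_multiply, Matrix.fromBlocks_multiply,
    Matrix.fromBlocks_neg]
  simp [hB, hS, hA]

theorem canonInvol_mul_recMat_pow_even (x : AIdx m → ℝ) {a : ℕ} (ha : Even a) :
    canonInvol m * recMat x ^ a = recMat (invol x) ^ a * canonInvol m := by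
  obtain ⟨b, rfl⟩ := ha
  induction b with
  | zero => simp
  | succ b ih =>
    rw [show b + 1 + (b + 1) = b + b + 1 + 1 by ring, pow_succ, pow_succ, ← mul_assoc, ← mul_assoc, ih,
      mul_assoc _ (canonInvol m), canonInvol_mul_recMat, mul_neg, neg_mul, mul_assoc, mul_assoc,
      canonInvol_mul_recMat, pow_succ, pow_succ]
    simp [mul_assoc]

/-- For odd k the exponent k - 1 is even, so the sign from `canonInvol_mul_recMat` disappears, and
the lift preserves J₁. -/
theorem involMat_conj_todaTensor {k : ℕ} (hk : Odd k) (x : AIdx m → ℝ) :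
    involMat m * todaTensor m k x * (involMat m)ᵀ = todaTensor m k (invol x) := by
  have hk' : Even (k - 1) := Nat.Odd.sub_odd hk odd_one
  have h1 := congrArg Matrix.transpose (involMat_mul_jacMat x)
  rw [Matrix.transpose_mul, Matrix.transpose_mul, canonInvol_transpose] at h1
  have h2 : canonInvol m * (recMat x ^ (k - 1) * symp ℝ m) * canonInvol m =
      recMat (invol x) ^ (k - 1) * symp ℝ m := by
    rw [← mul_assoc, canonInvol_mul_recMat_pow_even x hk', mul_assoc _ (canonInvol m),
      canonInvol_mul_symp, mul_assoc, mul_assoc, canonInvol_mul_self, mul_one]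
  rw [todaTensor_eq_tensorMat, todaTensor_eq_tensorMat, tensorMat, tensorMat, ← h2, Matrix.mul_assoc,
    Matrix.mul_assoc, Matrix.mul_assoc, h1, ← Matrix.mul_assoc, involMat_mul_jacMat]
  simp only [Matrix.mul_assoc]

end Reversal

/-! ### Brackets and gradients under linear maps -/

section LinearMaps

variable {ι κ : Type*} [Fintype ι] [DecidableEq ι] [Fintype κ] [DecidableEq κ]

theorem pderiv_comp_mulVec (A : Matrix ι κ ℝ) {F : (ι → ℝ) → ℝ} (hF : Differentiable ℝ F) (y : κ → ℝ) :
    (fun j => pderiv j (fun y => F (A *ᵥ y)) y) = Aᵀ *ᵥ (fun i => pderiv i F (A *ᵥ y)) := by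
  ext j
  have hA : HasFDerivAt (fun y : κ → ℝ => A *ᵥ y) (LinearMap.toContinuousLinearMap A.mulVecLin) y :=
    (LinearMap.toContinuousLinearMap A.mulVecLin).hasFDerivAt
  have h := ((hF (A *ᵥ y)).hasFDerivAt.comp y hA).fderiv
  have h' : fderiv ℝ (fun y => F (A *ᵥ y)) y =
      (fderiv ℝ F (A *ᵥ y)).comp (LinearMap.toContinuousLinearMap A.mulVecLin) := h
  rw [pderiv, h']
  have hcol : A *ᵥ Pi.single j 1 = ∑ i, A i j • Pi.single (M := fun _ => ℝ) i 1 := by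
    ext i
    simp [Finset.sum_apply, Pi.single_apply]
  simp [hcol, Matrix.mulVec, dotProduct, pderiv]

theorem bracket_eq_dotProduct (π : Bivector ι) (F G : (ι → ℝ) → ℝ) (x : ι → ℝ) :
    bracket π F G x = (fun i => pderiv i F x) ⬝ᵥ (π x *ᵥ fun j => pderiv j G x) := by
  simp only [bracket, dotProduct, Matrix.mulVec, Finset.mul_sum]
  exact Finset.sum_congr rfl fun _ _ => Finset.sum_congr rfl fun _ _ => by ring

theorem bracket_comp_mulVec (A : Matrix ι κ ℝ) (ρ : Bivector κ) {F G : (ι → ℝ) → ℝ}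
    (hF : Differentiable ℝ F) (hG : Differentiable ℝ G) (y : κ → ℝ) :
    bracket ρ (fun y => F (A *ᵥ y)) (fun y => G (A *ᵥ y)) y =
      (fun i => pderiv i F (A *ᵥ y)) ⬝ᵥ ((A * ρ y * Aᵀ) *ᵥ fun j => pderiv j G (A *ᵥ y)) := by
  rw [bracket_eq_dotProduct, pderiv_comp_mulVec A hF, pderiv_comp_mulVec A hG, Matrix.mulVec_mulVec,
    Matrix.mulVec_transpose, ← Matrix.dotProduct_mulVec, Matrix.mulVec_mulVec, Matrix.mul_assoc]

end LinearMaps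

theorem isPoissonMap_invol (m : ℕ) {k : ℕ} (hk : Odd k) : IsPoissonMap (todaTensor m k) invol := by
  intro F G hF hG x
  have h : (invol : (AIdx m → ℝ) → _) = fun x => involMat m *ᵥ x :=
    funext fun x => (involMat_mulVec x).symm
  have hb := bracket_comp_mulVec (involMat m) (todaTensor m k) (hF.differentiable (by simp))
    (hG.differentiable (by simp)) x
  rw [involMat_conj_todaTensor hk, involMat_mulVec, ← bracket_eq_dotProduct] at hb
  rw [← hb]
  simp only [involMat_mulVec]
  rfl

/-! ### The embedding as a matrix E, with EᵀE = 2 and EEᵀ = 1 + φ -/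

section Embedding

variable {n : ℕ}

/-- The matrix of the linear map `embed`. -/
def embedMat (n : ℕ) : Matrix (AIdx (2 * n)) (BIdx n) ℝ :=
  Matrix.fromBlocks
    (Matrix.of fun i j => (if (i : ℕ) = j then 1 else 0) + (if (i : ℕ) + j + 1 = 2 * n then 1 else 0))
    0 0
    (Matrix.of fun i j => (if (i : ℕ) = j then 1 else 0) - (if (i : ℕ) + j = 2 * n then 1 else 0))

theorem sum_ite_val_eq {N : ℕ} (i : ℕ) (f : Fin N → ℝ) :
    ∑ j : Fin N, (if i = (j : ℕ) then f j else 0) = if h : i < N then f ⟨i, h⟩ else 0 := by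
  split_ifs with h
  · rw [Finset.sum_eq_single ⟨i, h⟩]
    · simp
    · intro j _ hj
      rw [if_neg fun h' => hj (Fin.ext h'.symm)]
    · simp
  · exact Finset.sum_eq_zero fun j _ => if_neg (by omega)

theorem embedMat_mulVec (y : BIdx n → ℝ) : embedMat n *ᵥ y = embed y := by
  rw [embedMat, Matrix.fromBlocks_mulVec]
  ext (i | i)
  · have hi := i.isLt
    have h1 : ∀ j : Fin n, (if (i : ℕ) + j + 1 = 2 * n then y (Sum.inl j) else 0) =
        if 2 * n - 1 - i = (j : ℕ) then y (Sum.inl j) else 0 := fun j =>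
      if_congr (by omega) rfl rfl
    simp only [embed, Sum.elim_inl, Pi.add_apply, Matrix.zero_mulVec, Pi.zero_apply, add_zero,
      Matrix.mulVec, dotProduct, Matrix.of_apply, Function.comp_apply, add_mul, ite_mul, one_mul,
      zero_mul, Finset.sum_add_distrib, h1, sum_ite_val_eq i fun j : Fin n => y (Sum.inl j),
      sum_ite_val_eq (2 * n - 1 - i) fun j : Fin n => y (Sum.inl j)]
    split_ifs <;> first | omega | simp
  · have hi := i.isLt
    have h1 : ∀ j : Fin n, (if (i : ℕ) + j = 2 * n then y (Sum.inr j) else 0) =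
        if 2 * n - i = (j : ℕ) then y (Sum.inr j) else 0 := fun j =>
      if_congr (by omega) rfl rfl
    simp only [embed, Sum.elim_inr, Pi.add_apply, Matrix.zero_mulVec, Pi.zero_apply, zero_add,
      Matrix.mulVec, dotProduct, Matrix.of_apply, Function.comp_apply, sub_mul, ite_mul, one_mul,
      zero_mul, Finset.sum_sub_distrib, h1, sum_ite_val_eq i fun j : Fin n => y (Sum.inr j),
      sum_ite_val_eq (2 * n - i) fun j : Fin n => y (Sum.inr j)]
    split_ifs <;> first | omega | simp

theorem embedMat_transpose_mulVec (x : AIdx (2 * n) → ℝ) : (embedMat n)ᵀ *ᵥ x =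
    Sum.elim (fun j : Fin n => x (Sum.inl ⟨j, by omega⟩) + x (Sum.inl ⟨2 * n - 1 - j, by omega⟩))
      (fun j : Fin n => x (Sum.inr ⟨j, by omega⟩) - x (Sum.inr ⟨2 * n - j, by omega⟩)) := by
  rw [embedMat, Matrix.fromBlocks_transpose, Matrix.fromBlocks_mulVec]
  ext (j | j)
  · have hj := j.isLt
    have h0 : ∀ i : Fin (2 * n), (if (i : ℕ) = j then x (Sum.inl i) else 0) =
        if (j : ℕ) = i then x (Sum.inl i) else 0 := fun i => if_congr eq_comm rfl rfl
    have h1 : ∀ i : Fin (2 * n), (if (i : ℕ) + j + 1 = 2 * n then x (Sum.inl i) else 0) =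
        if 2 * n - 1 - j = (i : ℕ) then x (Sum.inl i) else 0 := fun i =>
      if_congr (by omega) rfl rfl
    simp only [Sum.elim_inl, Pi.add_apply, Matrix.transpose_zero, Matrix.zero_mulVec, Pi.zero_apply,
      add_zero, Matrix.mulVec, dotProduct, Matrix.transpose_apply, Matrix.of_apply,
      Function.comp_apply, add_mul, ite_mul, one_mul,
      zero_mul, Finset.sum_add_distrib, h0, h1, sum_ite_val_eq j fun i : Fin (2 * n) => x (Sum.inl i),
      sum_ite_val_eq (2 * n - 1 - j) fun i : Fin (2 * n) => x (Sum.inl i)]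
    rw [dif_pos, dif_pos]
  · have hj := j.isLt
    have h0 : ∀ i : Fin (2 * n + 1), (if (i : ℕ) = j then x (Sum.inr i) else 0) =
        if (j : ℕ) = i then x (Sum.inr i) else 0 := fun i => if_congr eq_comm rfl rfl
    have h1 : ∀ i : Fin (2 * n + 1), (if (i : ℕ) + j = 2 * n then x (Sum.inr i) else 0) =
        if 2 * n - j = (i : ℕ) then x (Sum.inr i) else 0 := fun i =>
      if_congr (by omega) rfl rfl
    simp only [Sum.elim_inr, Pi.add_apply, Matrix.transpose_zero, Matrix.zero_mulVec, Pi.zero_apply,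
      zero_add, Matrix.mulVec, dotProduct, Matrix.transpose_apply, Matrix.of_apply,
      Function.comp_apply, sub_mul, ite_mul, one_mul, zero_mul, Finset.sum_sub_distrib, h0, h1,
      sum_ite_val_eq j fun i : Fin (2 * n + 1) => x (Sum.inr i),
      sum_ite_val_eq (2 * n - j) fun i : Fin (2 * n + 1) => x (Sum.inr i)]
    rw [dif_pos, dif_pos]

theorem involMat_mul_embedMat : involMat (2 * n) * embedMat n = embedMat n := by
  refine Matrix.ext_of_mulVec_single fun i => ?_
  rw [← Matrix.mulVec_mulVec, embedMat_mulVec, involMat_mulVec]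
  exact (range_embed n).subset ⟨_, rfl⟩

theorem embedMat_transpose_mul_embedMat : (embedMat n)ᵀ * embedMat n = (2 : ℝ) • 1 := by
  refine Matrix.ext_of_mulVec_single fun i => ?_
  generalize Pi.single (M := fun _ => ℝ) i 1 = y
  rw [← Matrix.mulVec_mulVec, embedMat_mulVec, embedMat_transpose_mulVec, Matrix.smul_mulVec,
    Matrix.one_mulVec]
  ext (j | j)
  · have hj := j.isLt
    have e : 2 * n - 1 - (2 * n - 1 - (j : ℕ)) = j := by omega
    simp [embed, e, show ¬ 2 * n - 1 - (j : ℕ) < n by omega]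
    ring
  · have hj := j.isLt
    have e : 2 * n - (2 * n - (j : ℕ)) = j := by omega
    simp [embed, e, show ¬ 2 * n - (j : ℕ) < n by omega, show n < 2 * n - (j : ℕ) by omega]
    ring

theorem embedMat_mul_transpose : embedMat n * (embedMat n)ᵀ = 1 + involMat (2 * n) := by
  refine Matrix.ext_of_mulVec_single fun i => ?_
  generalize Pi.single (M := fun _ => ℝ) i 1 = x
  rw [← Matrix.mulVec_mulVec, embedMat_mulVec, embedMat_transpose_mulVec, Matrix.add_mulVec,
    Matrix.one_mulVec, involMat_mulVec]
  ext (j | j)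
  · have hj := j.isLt
    simp only [embed, invol, Sum.elim_inl, Pi.add_apply]
    split_ifs with h
    · congr 3
      ext
      simp only [Fin.val_rev]
      omega
    · rw [add_comm]
      congr 3 <;> ext <;> simp only [Fin.val_rev] <;> omega
  · have hj := j.isLt
    simp only [embed, invol, Sum.elim_inr, Pi.add_apply]
    split_ifs with h h'
    · rw [sub_eq_add_neg]
      congr 4
      ext
      simp only [Fin.val_rev]
      omega
    · rw [neg_sub, sub_eq_add_neg]
      have e1 : (⟨2 * n - (2 * n - (j : ℕ)), by omega⟩ : Fin (2 * n + 1)) = j := by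
        ext
        simp only
        omega
      have e2 : (⟨2 * n - (j : ℕ), by omega⟩ : Fin (2 * n + 1)) = j.rev := by
        ext
        simp only [Fin.val_rev]
        omega
      rw [e1, e2]
    · have : j.rev = j := by
        ext
        simp only [Fin.val_rev]
        omega
      rw [this]
      ring

theorem involMat_mulVec_embedMat_mulVec (y : BIdx n → ℝ) :
    invol (embedMat n *ᵥ y) = embedMat n *ᵥ y := by
  rw [← involMat_mulVec, Matrix.mulVec_mulVec, involMat_mul_embedMat]

end Embedding

/-! ### The induced tensor: Poisson property, restriction and uniqueness -/

section BTensor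

variable {n : ℕ}

/-- The bivector induced by the `k`-th Toda tensor on the fixed point set of the involution. -/
noncomputable def bTensor (n k : ℕ) : Bivector (BIdx n) := fun y =>
  (1 / 4 : ℝ) • ((embedMat n)ᵀ * todaTensor (2 * n) k (embedMat n *ᵥ y) * embedMat n)

theorem embedMat_transpose_mul_involMat :
    (embedMat n)ᵀ * involMat (2 * n) = (embedMat n)ᵀ := by
  have := congrArg Matrix.transpose (involMat_mul_embedMat (n := n))
  rwa [Matrix.transpose_mul, involMat_transpose] at this

theorem todaTensor_mul_involMat {m k : ℕ} (hk : Odd k) {x : AIdx m → ℝ} (hx : invol x = x) :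
    todaTensor m k x * involMat m = involMat m * todaTensor m k x := by
  have h := involMat_conj_todaTensor hk x
  rw [hx, involMat_transpose] at h
  conv_lhs => rw [← h]
  rw [Matrix.mul_assoc _ (involMat m) (involMat m), involMat_mul_self, Matrix.mul_one]

/-- At a fixed point π commutes with φ, so Eᵀπ(1 + φ) = Eᵀπ + Eᵀφπ, and Eᵀφ = Eᵀ. -/
theorem embedMat_transpose_mul_todaTensor {k : ℕ} (hk : Odd k) (y : BIdx n → ℝ) :
    (embedMat n)ᵀ * todaTensor (2 * n) k (embedMat n *ᵥ y) * (embedMat n * (embedMat n)ᵀ) =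
      (2 : ℝ) • ((embedMat n)ᵀ * todaTensor (2 * n) k (embedMat n *ᵥ y)) := by
  rw [embedMat_mul_transpose, Matrix.mul_add, Matrix.mul_one, Matrix.mul_assoc,
    todaTensor_mul_involMat hk (involMat_mulVec_embedMat_mulVec y), ← Matrix.mul_assoc,
    embedMat_transpose_mul_involMat, two_smul]

/-- The matrix of `embed` with entries regarded as constant polynomials. -/
noncomputable def embedPoly (n : ℕ) : Matrix (AIdx (2 * n)) (BIdx n) (PolyFun (2 * n)) :=
  (embedMat n).map MvPolynomial.C

/-- The entries of `bTensor`, as polynomials on the `A_{2n}`-Toda phase space. -/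
noncomputable def bTensorPoly (n k : ℕ) : Matrix (BIdx n) (BIdx n) (PolyFun (2 * n)) :=
  (embedPoly n)ᵀ * tensorMat (2 * n) k (MvPolynomial.X : _ → PolyFun (2 * n)) * embedPoly n

theorem map_eval_tensorMat {m k : ℕ} (x : AIdx m → ℝ) :
    (tensorMat m k (MvPolynomial.X : _ → PolyFun m)).map (MvPolynomial.eval x) = todaTensor m k x := by
  ext i j
  rw [todaTensor_apply_eq_eval, Matrix.map_apply]

theorem map_eval_embedPoly (x : AIdx (2 * n) → ℝ) :
    (embedPoly n).map (MvPolynomial.eval x) = embedMat n := by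
  ext i j
  simp [embedPoly]

theorem bTensor_apply_eq_eval (k : ℕ) (y : BIdx n → ℝ) (i j : BIdx n) :
    bTensor n k y i j = 1 / 4 * MvPolynomial.eval (embedMat n *ᵥ y) (bTensorPoly n k i j) := by
  rw [← Matrix.map_apply (f := MvPolynomial.eval (embedMat n *ᵥ y)), bTensorPoly, Matrix.map_mul,
    Matrix.map_mul, Matrix.transpose_map, map_eval_embedPoly, map_eval_tensorMat]
  rfl

theorem pderiv_bTensor (k : ℕ) (y : BIdx n → ℝ) (i j l : BIdx n) :
    pderiv l (fun y => bTensor n k y i j) y = 1 / 4 * ∑ s, embedMat n s l *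
      MvPolynomial.eval (embedMat n *ᵥ y) (MvPolynomial.pderiv s (bTensorPoly n k i j)) := by
  have h := congrFun (pderiv_comp_mulVec (embedMat n)
    (differentiable_eval (MvPolynomial.C (1 / 4) * bTensorPoly n k i j)) y) l
  simp only [pderiv_eval, Matrix.mulVec, dotProduct, Matrix.transpose_apply] at h
  simp only [bTensor_apply_eq_eval, Finset.mul_sum]
  simpa [-Fintype.sum_sum_type, Matrix.mulVec, dotProduct, Derivation.leibniz, mul_left_comm] using h

theorem isPoissonTensor_bTensor {k : ℕ} (hk : Odd k) : IsPoissonTensor (bTensor n k) where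
  smooth i j := by
    simp only [bTensor_apply_eq_eval]
    exact contDiff_const.mul
      ((contDiff_eval _).comp (LinearMap.toContinuousLinearMap (embedMat n).mulVecLin).contDiff)
  skew y i j := by
    have : (bTensor n k y)ᵀ = -bTensor n k y := by
      rw [bTensor, Matrix.transpose_smul, Matrix.transpose_mul, Matrix.transpose_mul,
        Matrix.transpose_transpose, todaTensor_transpose, Matrix.neg_mul, Matrix.mul_neg, smul_neg,
        Matrix.mul_assoc]
    rw [← Matrix.transpose_apply (bTensor n k y), this, Matrix.neg_apply]
  jacobi y i j l := by
    set x := embedMat n *ᵥ y with hx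
    -- Differentiating the B-tensor along its own rows is, up to a factor, differentiating the
    -- ambient polynomials along the rows of Eᵀπ. The factor 1/8 is ¼ · ¼ from the two tensors times
    -- the 2 of `embedMat_transpose_mul_todaTensor`. The Jacobi identity then follows from
    -- `jacobiator_pushforward` with constant Jacobian Eᵀ.
    have key : ∀ i j l, ∑ s, bTensor n k y i s * pderiv s (fun z => bTensor n k z j l) y =
        1 / 8 * MvPolynomial.eval x (dirDeriv (MvPolynomial.pderiv (R := ℝ))
          (((embedPoly n)ᵀ * tensorMat (2 * n) k (MvPolynomial.X : _ → PolyFun (2 * n))) i)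
          (bTensorPoly n k j l)) := by
      intro i j l
      have h := embedMat_transpose_mul_todaTensor hk y
      have h1 : ∀ t, ∑ s, bTensor n k y i s * embedMat n t s =
          1 / 2 * ((embedMat n)ᵀ * todaTensor (2 * n) k x) i t := fun t => by
        have h2 := congrFun₂ h i t
        rw [← Matrix.mul_assoc, Matrix.mul_apply] at h2
        simp only [bTensor, Matrix.smul_apply, smul_eq_mul, Matrix.transpose_apply, ← hx] at h2 ⊢
        simp only [mul_assoc (1 / 4 : ℝ), ← Finset.mul_sum, h2]
        ring
      have h3 : ∀ t, MvPolynomial.eval x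
          (((embedPoly n)ᵀ * tensorMat (2 * n) k (MvPolynomial.X : _ → PolyFun (2 * n))) i t) =
          ((embedMat n)ᵀ * todaTensor (2 * n) k x) i t := fun t => by
        rw [← Matrix.map_apply (f := MvPolynomial.eval x), Matrix.map_mul, Matrix.transpose_map,
          map_eval_embedPoly, map_eval_tensorMat]
      simp only [pderiv_bTensor, dirDeriv_apply, map_sum, map_mul, h3, ← hx, Finset.mul_sum]
      rw [Finset.sum_comm]
      refine Finset.sum_congr rfl fun t _ => ?_
      have h4 := h1 t
      have h5 : ∀ s, bTensor n k y i s * (1 / 4 * (embedMat n t s *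
          MvPolynomial.eval x (MvPolynomial.pderiv t (bTensorPoly n k j l)))) =
          (bTensor n k y i s * embedMat n t s) *
            (1 / 4 * MvPolynomial.eval x (MvPolynomial.pderiv t (bTensorPoly n k j l))) :=
        fun s => by ring
      simp only [h5]
      rw [← Finset.sum_mul, h4]
      ring
    rw [Finset.sum_add_distrib, Finset.sum_add_distrib, key, key, key, ← mul_add, ← mul_add,
      ← map_add, ← map_add, bTensorPoly]
    have := jacobiator_pushforward (MvPolynomial.pderiv (R := ℝ) (σ := AIdx (2 * n)))
      (tensorMat (2 * n) k (MvPolynomial.X : _ → PolyFun (2 * n))) (embedPoly n)ᵀ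
      (tensorMat_transpose _ _ _) (by simp [embedPoly]) (tensorMat_jacobi _ _) i j l
    rw [Matrix.transpose_transpose] at this
    rw [this]
    simp

theorem embed_eq_mulVec : (embed : (BIdx n → ℝ) → _) = fun y => embedMat n *ᵥ y :=
  funext fun y => (embedMat_mulVec y).symm

theorem pderiv_of_comp_invol_eq {m : ℕ} {F : (AIdx m → ℝ) → ℝ} (hF : Differentiable ℝ F)
    (h : F ∘ invol = F) {x : AIdx m → ℝ} (hx : invol x = x) :
    involMat m *ᵥ (fun i => pderiv i F x) = fun i => pderiv i F x := by
  have h1 := pderiv_comp_mulVec (involMat m) hF x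
  have h2 : (fun x => F (involMat m *ᵥ x)) = F := by
    simp only [involMat_mulVec]
    exact h
  rw [h2, involMat_mulVec, hx, involMat_transpose] at h1
  exact h1.symm

theorem embedMat_mulVec_transpose_mulVec_pderiv {F : (AIdx (2 * n) → ℝ) → ℝ}
    (hF : Differentiable ℝ F) (h : F ∘ invol = F) (y : BIdx n → ℝ) :
    embedMat n *ᵥ ((embedMat n)ᵀ *ᵥ fun i => pderiv i F (embedMat n *ᵥ y)) =
      (2 : ℝ) • fun i => pderiv i F (embedMat n *ᵥ y) := by
  rw [Matrix.mulVec_mulVec, embedMat_mul_transpose, Matrix.add_mulVec, Matrix.one_mulVec,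
    pderiv_of_comp_invol_eq hF h (involMat_mulVec_embedMat_mulVec y), two_smul]

/-- Gradients of invariant functions at fixed points are fixed by φ, so EEᵀ doubles each of them;
the two factors 2 cancel the ¼ of `bTensor`. -/
theorem isInducedOnFixedSet_bTensor (k : ℕ) :
    IsInducedOnFixedSet invol embed (todaTensor (2 * n) k) (bTensor n k) := by
  intro F G hF hG hFi hGi y
  have hF' : Differentiable ℝ F := hF.differentiable (by simp)
  have hG' : Differentiable ℝ G := hG.differentiable (by simp)
  rw [embed_eq_mulVec]
  have h := bracket_comp_mulVec (embedMat n) (bTensor n k) hF' hG' y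
  change bracket (bTensor n k) (F ∘ fun y => embedMat n *ᵥ y) (G ∘ fun y => embedMat n *ᵥ y) y = _ at h
  rw [h, bracket_eq_dotProduct]
  have h1 := embedMat_mulVec_transpose_mulVec_pderiv hF' hFi y
  have h2 := embedMat_mulVec_transpose_mulVec_pderiv hG' hGi y
  set f := fun i => pderiv i F (embedMat n *ᵥ y)
  set g := fun i => pderiv i G (embedMat n *ᵥ y)
  have h3 : f ᵥ* embedMat n ᵥ* (embedMat n)ᵀ = (2 : ℝ) • f := by
    rw [Matrix.vecMul_transpose, ← Matrix.mulVec_transpose, h1]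
  rw [bTensor, Matrix.mul_smul, Matrix.smul_mul, Matrix.smul_mulVec, dotProduct_smul]
  simp only [← Matrix.mulVec_mulVec, Matrix.mul_assoc]
  rw [h2, Matrix.dotProduct_mulVec f (embedMat n), Matrix.dotProduct_mulVec _ (embedMat n)ᵀ, h3,
    Matrix.mulVec_smul, dotProduct_smul,
    smul_dotProduct]
  simp only [smul_eq_mul]
  ring

theorem contDiff_mulVec_apply {ι κ : Type*} [Fintype ι] [DecidableEq ι] [Fintype κ]
    (A : Matrix κ ι ℝ) (j : κ) : ContDiff ℝ ∞ (fun x : ι → ℝ => (A *ᵥ x) j) :=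
  (contDiff_apply ℝ ℝ j).comp (LinearMap.toContinuousLinearMap A.mulVecLin).contDiff

theorem pderiv_coord {ι : Type*} [Fintype ι] [DecidableEq ι] (i j : ι) (y : ι → ℝ) :
    pderiv i (fun y => y j) y = if i = j then 1 else 0 := by
  have := pderiv_eval (MvPolynomial.X j) i y
  simp only [MvPolynomial.eval_X] at this
  rw [this, MvPolynomial.pderiv_X]
  by_cases h : i = j
  · subst h
    simp
  · simp [h, Ne.symm h]

theorem bracket_coord {ι : Type*} [Fintype ι] [DecidableEq ι] (ρ : Bivector ι) (i j : ι) (y : ι → ℝ) :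
    bracket ρ (fun y => y i) (fun y => y j) y = ρ y i j := by
  simp [bracket, pderiv_coord]

theorem eq_of_isInducedOnFixedSet {π : Bivector (AIdx (2 * n))} {ρ ρ' : Bivector (BIdx n)}
    (h : IsInducedOnFixedSet invol embed π ρ) (h' : IsInducedOnFixedSet invol embed π ρ') :
    ρ = ρ' := by
  funext y
  ext i j
  -- The functions ½Eᵀx are φ-invariant and restrict to the coordinates, so their brackets determine
  -- every entry of an induced tensor.
  let F : BIdx n → (AIdx (2 * n) → ℝ) → ℝ := fun i x => (((1 / 2 : ℝ) • (embedMat n)ᵀ) *ᵥ x) i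
  have hs : ∀ i, ContDiff ℝ ∞ (F i) := fun i => contDiff_mulVec_apply _ i
  have hi : ∀ i, F i ∘ invol = F i := fun i => by
    ext x
    simp only [F, Function.comp_apply, ← involMat_mulVec, Matrix.mulVec_mulVec, Matrix.smul_mul,
      embedMat_transpose_mul_involMat]
  have he : ∀ i, F i ∘ embed = fun y => y i := fun i => by
    ext y
    simp only [F, Function.comp_apply, ← embedMat_mulVec, Matrix.mulVec_mulVec, Matrix.smul_mul,
      embedMat_transpose_mul_embedMat, smul_smul]
    norm_num
  have h1 := h (F i) (F j) (hs i) (hs j) (hi i) (hi j) y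
  have h2 := h' (F i) (F j) (hs i) (hs j) (hi i) (hi j) y
  rw [h1, he, he, bracket_coord, bracket_coord] at h2
  exact h2

end BTensor

/-! ### Even Hamiltonians, restricted Hamiltonian fields and the B_n-Lax equation -/

section Hamiltonians

theorem conj_pow {N : ℕ} {K : Matrix (Fin N) (Fin N) ℝ} (hK : K * K = 1)
    (A : Matrix (Fin N) (Fin N) ℝ) (j : ℕ) : (K * A * K) ^ j = K * A ^ j * K := by
  induction j with
  | zero => simp [hK]
  | succ j ih =>
    rw [pow_succ, ih, pow_succ]
    have : K * A ^ j * K * (K * A * K) = K * A ^ j * (K * K) * A * K := by noncomm_ring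
    rw [this, hK]
    noncomm_ring

theorem trace_conj {N : ℕ} {K : Matrix (Fin N) (Fin N) ℝ} (hK : K * K = 1)
    (A : Matrix (Fin N) (Fin N) ℝ) : (K * A * K).trace = A.trace := by
  rw [Matrix.trace_mul_comm, ← mul_assoc, hK, one_mul]

theorem hamA_invol {m j : ℕ} (hj : Even j) (x : AIdx m → ℝ) : hamA j (invol x) = hamA j x := by
  set K : Matrix (Fin (m + 1)) (Fin (m + 1)) ℝ := Matrix.diagonal fun i => (-1) ^ (i : ℕ) with hK
  have hsq : ∀ i : ℕ, (-1 : ℝ) ^ i * (-1) ^ i = 1 := fun i => by rw [← mul_pow]; simp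
  have hKK : K * K = 1 := by
    rw [hK, Matrix.diagonal_mul_diagonal]
    simp [hsq]
  -- Reversal turns the Lax matrix of φ(x) into -(K L K)ᵀ, with K the alternating signs. Trace and
  -- even powers see neither the sign, nor the transpose, nor the conjugations.
  have h : revMat (m + 1) * lax (invol x) * revMat (m + 1) = -(K * lax x * K)ᵀ := by
    ext i j
    have hi := i.isLt
    have hj := j.isLt
    rw [mul_revMat_apply, revMat_mul_apply, Matrix.neg_apply, Matrix.transpose_apply, hK,
      Matrix.mul_diagonal, Matrix.diagonal_mul, lax_eq_laxMat, lax_eq_laxMat]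
    have hneg : ∀ a b : ℕ, a + 1 = b → (-1 : ℝ) ^ a * (-1) ^ b = -1 := fun a b hab => by
      rw [← hab, pow_succ]
      linear_combination -hsq a
    have eB : diagPart (invol x) i.rev j.rev = -diagPart x j i := by
      simp only [diagPart, Matrix.diagonal_apply, invol, Sum.elim_inr, Fin.rev_rev, Fin.rev_inj]
      by_cases h : i = j
      · simp [h]
      · simp [h, Ne.symm h]
    have eV : subDiag ℝ m i.rev j.rev = subDiag ℝ m j i := by
      simp only [subDiag, Matrix.of_apply, Fin.val_rev]
      exact if_congr (by omega) rfl rfl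
    have sU : (-1 : ℝ) ^ (j : ℕ) * (-1) ^ (i : ℕ) * supDiag x j i = -supDiag x j i := by
      by_cases h : (j : ℕ) + 1 = i
      · rw [hneg _ _ h, neg_one_mul]
      · rw [supDiag_apply_eq_zero x h]
        ring
    have sV : (-1 : ℝ) ^ (j : ℕ) * (-1) ^ (i : ℕ) * subDiag ℝ m j i = -subDiag ℝ m j i := by
      by_cases h : (i : ℕ) + 1 = j
      · rw [mul_comm ((-1 : ℝ) ^ (j : ℕ)), hneg _ _ h, neg_one_mul]
      · simp [subDiag, h]
    have sB : (-1 : ℝ) ^ (j : ℕ) * (-1) ^ (i : ℕ) * diagPart x j i = diagPart x j i := by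
      by_cases h : j = i
      · rw [h, hsq, one_mul]
      · rw [diagPart, Matrix.diagonal_apply_ne _ h, mul_zero]
    simp only [laxMat, Matrix.add_apply]
    rw [supDiag_invol, Fin.rev_rev, eB, eV]
    linear_combination sU + sV + sB
  have hpow := congrArg (fun A => (A ^ j).trace) h
  simp only [conj_pow revMat_mul_revMat, trace_conj revMat_mul_revMat, hj.neg_pow,
    ← Matrix.transpose_pow, Matrix.trace_transpose, conj_pow hKK, trace_conj hKK] at hpow
  rw [hamA, hamA, hpow]

variable {n : ℕ}

/-- The diagonal matrix of signs which conjugates `laxB` to `lax`. -/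
def signDiag (n : ℕ) : Matrix (Fin (2 * n + 1)) (Fin (2 * n + 1)) ℝ :=
  Matrix.diagonal fun i : Fin (2 * n + 1) => (-1 : ℝ) ^ ((i : ℕ) - n)

theorem signDiag_mul_self : signDiag n * signDiag n = 1 := by
  rw [signDiag, Matrix.diagonal_mul_diagonal]
  simp [← mul_pow]

theorem laxB_eq_signDiag_conj (y : BIdx n → ℝ) :
    laxB y = signDiag n * lax (embedMat n *ᵥ y) * signDiag n := by
  rw [embedMat_mulVec, laxB_eq_conj, signDiag]

theorem hamB_eq_hamA (j : ℕ) : (hamB j : (BIdx n → ℝ) → ℝ) = fun y => hamA j (embedMat n *ᵥ y) := by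
  funext y
  rw [hamB, hamA, laxB_eq_signDiag_conj, conj_pow signDiag_mul_self, trace_conj signDiag_mul_self]

theorem differentiable_hamA {m : ℕ} (j : ℕ) : Differentiable ℝ (hamA (m := m) j) := by
  rw [funext (hamA_eq_eval (m := m) j)]
  exact differentiable_eval _

theorem hamVec_bTensor_hamB (k : ℕ) {j : ℕ} (hj : Even j) (y : BIdx n → ℝ) :
    hamVec (bTensor n k) (hamB j) y = (1 / 2 : ℝ) • ((embedMat n)ᵀ *ᵥ
      hamVec (todaTensor (2 * n) k) (hamA j) (embedMat n *ᵥ y)) := by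
  have h := embedMat_mulVec_transpose_mulVec_pderiv (differentiable_hamA j)
    (funext (hamA_invol hj)) y
  rw [hamVec, hamB_eq_hamA, pderiv_comp_mulVec _ (differentiable_hamA j), hamVec, bTensor,
    Matrix.smul_mulVec, ← Matrix.mulVec_mulVec, h, Matrix.mulVec_smul, ← Matrix.mulVec_mulVec,
    smul_smul]
  norm_num

/-- By oddness of k and evenness of j the ambient Hamiltonian field is fixed by φ, hence tangent to
the fixed set; ½EEᵀ is the identity on it. -/
theorem embedMat_mulVec_hamVec_bTensor {k : ℕ} (hk : Odd k) {j : ℕ} (hj : Even j) (y : BIdx n → ℝ) :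
    embedMat n *ᵥ hamVec (bTensor n k) (hamB j) y =
      hamVec (todaTensor (2 * n) k) (hamA j) (embedMat n *ᵥ y) := by
  have hx := involMat_mulVec_embedMat_mulVec y
  have h := pderiv_of_comp_invol_eq (differentiable_hamA j) (funext (hamA_invol hj)) hx
  rw [hamVec_bTensor_hamB k hj, Matrix.mulVec_smul, Matrix.mulVec_mulVec, embedMat_mul_transpose,
    Matrix.add_mulVec, Matrix.one_mulVec, hamVec, Matrix.mulVec_mulVec,
    ← todaTensor_mul_involMat hk hx, ← Matrix.mulVec_mulVec, h, ← two_smul ℝ, smul_smul]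
  norm_num

theorem hamVec_todaTensor_eq_todaFlow {m k j : ℕ} (hk : 1 ≤ k) (hj : 1 ≤ j) (x : AIdx m → ℝ) :
    hamVec (todaTensor m k) (hamA j) x = todaFlow (k + j - 2) x := by
  obtain ⟨k, rfl⟩ := Nat.exists_eq_add_of_le' hk
  obtain ⟨j, rfl⟩ := Nat.exists_eq_add_of_le' hj
  rw [hamVec_todaTensor_hamA, show k + 1 + (j + 1) - 2 = k + j by omega]

/-- The B-Lax matrix is affine in y: the conjugated subdiagonal is its constant term, and the rest
is linear. -/
theorem laxBDeriv_eq (y v : BIdx n → ℝ) : laxBDeriv y v =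
    signDiag n * (supDiag (embedMat n *ᵥ v) + diagPart (embedMat n *ᵥ v)) * signDiag n := by
  let T : (BIdx n → ℝ) →ₗ[ℝ] Matrix (Fin (2 * n + 1)) (Fin (2 * n + 1)) ℝ :=
    { toFun := fun v =>
        signDiag n * (supDiag (embedMat n *ᵥ v) + diagPart (embedMat n *ᵥ v)) * signDiag n
      map_add' := fun v w => by
        have h1 : ∀ x x' : AIdx (2 * n) → ℝ, supDiag (x + x') = supDiag x + supDiag x' := by
          intro x x'
          ext i j
          by_cases h : (i : ℕ) + 1 = j <;> simp [supDiag, h]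
        have h2 : ∀ x x' : AIdx (2 * n) → ℝ, diagPart (x + x') = diagPart x + diagPart x' := by
          intro x x'
          rw [diagPart, diagPart, diagPart, Matrix.diagonal_add]
          rfl
        rw [Matrix.mulVec_add, h1, h2]
        noncomm_ring
      map_smul' := fun c v => by
        have h1 : ∀ x : AIdx (2 * n) → ℝ, supDiag (c • x) = c • supDiag x := by
          intro x
          ext i j
          by_cases h : (i : ℕ) + 1 = j <;> simp [supDiag, h]
        have h2 : ∀ x : AIdx (2 * n) → ℝ, diagPart (c • x) = c • diagPart x := by
          intro x
          rw [diagPart, diagPart, ← Matrix.diagonal_smul]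
          rfl
        rw [Matrix.mulVec_smul, h1, h2, ← smul_add, Matrix.mul_smul, Matrix.smul_mul]
        rfl }
  ext i j
  let ℓ : (BIdx n → ℝ) →ₗ[ℝ] ℝ := (Matrix.entryLinearMap ℝ ℝ i j).comp T
  have h : (fun z : BIdx n → ℝ => laxB z i j) = fun z => LinearMap.toContinuousLinearMap ℓ z +
      (signDiag n * subDiag ℝ (2 * n) * signDiag n) i j := by
    funext z
    rw [laxB_eq_signDiag_conj, lax_eq_laxMat, laxMat, mul_add, add_mul, Matrix.add_apply]
    rfl
  rw [laxBDeriv, Matrix.of_apply, h, fderiv_add_const, ContinuousLinearMap.fderiv]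
  rfl

/-- Conjugation by a diagonal matrix only rescales each entry in place. -/
theorem upperPart_signDiag_conj (M : Matrix (Fin (2 * n + 1)) (Fin (2 * n + 1)) ℝ) :
    upperPart (signDiag n * M * signDiag n) = signDiag n * upperPart M * signDiag n := by
  ext i j
  simp only [signDiag, upperPart, Matrix.of_apply, Matrix.mul_diagonal, Matrix.diagonal_mul]
  split_ifs <;> simp

theorem laxField_signDiag_conj (s : ℕ) (M : Matrix (Fin (2 * n + 1)) (Fin (2 * n + 1)) ℝ) :
    laxField s (signDiag n * M * signDiag n) = signDiag n * laxField s M * signDiag n := by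
  have hc : ∀ A B : Matrix (Fin (2 * n + 1)) (Fin (2 * n + 1)) ℝ,
      signDiag n * A * signDiag n * (signDiag n * B * signDiag n) =
        signDiag n * (A * B) * signDiag n := fun A B => by
    have : signDiag n * A * signDiag n * (signDiag n * B * signDiag n) =
        signDiag n * A * (signDiag n * signDiag n) * B * signDiag n := by noncomm_ring
    rw [this, signDiag_mul_self]
    noncomm_ring
  rw [laxField, conj_pow signDiag_mul_self, upperPart_signDiag_conj, hc, hc, laxField, mul_sub, sub_mul]

end Hamiltonians
end BnToda

/-! ### The B_n-hierarchy -/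

theorem corollary3p3 (n : ℕ) :
    (∀ k : ℕ, Odd k →
      BnToda.IsPoissonTensor (BnToda.todaTensor (2 * n) k) ∧
      BnToda.IsPoissonMap (BnToda.todaTensor (2 * n) k) BnToda.invol) ∧
    ∃ π : ℕ → BnToda.Bivector (BnToda.BIdx n),
      (∀ k : ℕ, Odd k →
        BnToda.IsPoissonTensor (π k) ∧
        BnToda.IsInducedOnFixedSet BnToda.invol BnToda.embed
          (BnToda.todaTensor (2 * n) k) (π k) ∧
        ∀ ρ : BnToda.Bivector (BnToda.BIdx n), BnToda.IsPoissonTensor ρ →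
          BnToda.IsInducedOnFixedSet BnToda.invol BnToda.embed
            (BnToda.todaTensor (2 * n) k) ρ → ρ = π k) ∧
      (∀ k l : ℕ, Odd k → 1 ≤ l →
        BnToda.hamVec (π (k + 2)) (BnToda.hamB (2 * l)) =
          BnToda.hamVec (π k) (BnToda.hamB (2 * l + 2))) ∧
      (∀ k l : ℕ, Odd k → 1 ≤ l → ∀ y : BnToda.BIdx n → ℝ,
        BnToda.laxBDeriv y (BnToda.hamVec (π k) (BnToda.hamB (2 * l)) y) =
          BnToda.laxField (k + 2 * l - 2) (BnToda.laxB y)) := by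
  refine ⟨fun k hk => ⟨BnToda.isPoissonTensor_todaTensor k, BnToda.isPoissonMap_invol _ hk⟩,
    BnToda.bTensor n, fun k hk => ⟨BnToda.isPoissonTensor_bTensor hk,
      BnToda.isInducedOnFixedSet_bTensor k,
      fun ρ _ hρ => BnToda.eq_of_isInducedOnFixedSet hρ (BnToda.isInducedOnFixedSet_bTensor k)⟩,
    fun k l hk hl => ?_, fun k l hk hl y => ?_⟩
  -- Both sides restrict the same A-Toda field, of exponent k + 2l.
  · funext y
    rw [BnToda.hamVec_bTensor_hamB _ (even_two_mul l),
      BnToda.hamVec_bTensor_hamB _ ((even_two_mul l).add even_two),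
      BnToda.hamVec_todaTensor_eq_todaFlow (by omega) (by omega),
      BnToda.hamVec_todaTensor_eq_todaFlow hk.pos (by omega),
      show k + 2 + 2 * l - 2 = k + (2 * l + 2) - 2 by omega]
  · rw [BnToda.laxBDeriv_eq, BnToda.embedMat_mulVec_hamVec_bTensor hk (even_two_mul l),
      BnToda.hamVec_todaTensor_eq_todaFlow hk.pos (by omega), ← BnToda.laxField_lax,
      BnToda.laxB_eq_signDiag_conj, BnToda.laxField_signDiag_conj]
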